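/- Let $H$ be a real Hilbert space, $C\subseteq H$ a nonempty closed convex set, and $f:H\to\mathbb R$ a convex differentiable function whose gradient is $L$-Lipschitz continuous, $L>0$; put $\beta=1/L$. Let $\Omega$ be the set of minimizers of $f$ over $C$, and assume $\Omega\ne\emptyset$. For $\alpha\ge 0$, let $\mathcal P_\alpha(H)$ be the set of bounded self-adjoint operators $U$ on $H$ with $\langle Ux,x\rangle\ge\alpha\|x\|^2$ for all $x$, and write $U\succeq V$ if $\langle Ux,x\rangle\ge\langle Vx,x\rangle$ for all $x$. For $W\in\mathcal P_\delta(H)$ with $\delta>0$, put $\|x\|_W=\sqrt{\langle Wx,x\rangle}$ and $P_C^W(y)=\arg\min_{z\in C}\|y-z\|_W$. Let $\alpha>0$, let $(\eta_k)_{k\ge0}$ be a summable sequence in $[0,\infty)$, and let $U_k\in\mathcal P_\alpha(H)$ satisfy $$\mu=\sup_k\|U_k\|<\infty,\qquad (1+\eta_k)U_{k+1}\succeq U_k\quad\text{for all }k\ge 0.$$ Let $\gamma_k>0$ with $\gamma_k\|U_k\|<2\beta$, put $\alpha_k=\dfrac{2\beta}{4\beta-\gamma_k\|U_k\|}$, and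 let $\lambda_k\in(0,1/\alpha_k)$. Let $(a_k),(b_k)$ be sequences in $H$ with $\sum_k\lambda_k\|a_k\|<\infty$ and $\sum_k\lambda_k\|b_k\|<\infty$. Given $x_0\in H$, set, for $k\ge0$, $$y_k=x_k-\gamma_kU_k(\nabla f(x_k)+b_k),\qquad x_{k+1}=x_k+\lambda_k\bigl(P_C^{U_k^{-1}}(y_k)+a_k-x_k\bigr).$$ Consider the following assertions: 1. for every $x^*\in\Omega$, $\lim_{k}\|x_k-x^*\|_{U_k^{-1}}$ exists; 2. $\lim_{k}\bigl\|x_k-P_C^{U_k^{-1}}(x_k-\gamma_kU_k\nabla f(x_k))\bigr\|=0$; 3. $(x_k)$ converges weakly to a point of $\Omega$; 4. $\nabla f(x_k)\to\nabla f(x^*)$ in norm for every $x^*\in\Omega$. Then assertion 1 holds. Moreover: **(A)** If there are $\underline\lambda>0$ and $\tau>0$ with $\underline\lambda\le\lambda_k\le\frac1{\alpha_k}-\tau$ for all $k$, then assertion 2 holds. If in addition there is $\underline\gamma>0$ with $\gamma_k\ge\underline\gamma$ for all $k$, then assertion 3 holds. If in addition there is $\epsilon>0$ with $\gamma_k\mu\le2\beta-\epsilon$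 for all $k$, then assertion 4 holds. **(B)** Suppose that - $\sum_{k}\lambda_k\bigl(\frac1{\alpha_k}-\lambda_k\bigr)=+\infty$; - there are $\underline\gamma>0$ and $\epsilon>0$ with $\underline\gamma\le\gamma_k$ and $\gamma_k\mu\le2\beta-\epsilon$ for all $k$; - $\sum_k|\gamma_{k+1}-\gamma_k|<\infty$, $\ \sum_k\bigl|\gamma_{k+1}\|U_{k+1}\|-\gamma_k\|U_k\|\bigr|<\infty$, and $\sum_k\|U_k^{-1}v-U_{k+1}^{-1}v\|<\infty$ for every $v\in H$. Then assertions 2 and 3 hold. If in addition there is $\underline\lambda>0$ with $\lambda_k\ge\underline\lambda$ for all $k$, then assertion 4 holds. -/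

import Mathlib

open Filter Topology

noncomputable section

namespace VarMetric

variable {H : Type*} [NormedAddCommGroup H] [InnerProductSpace ℝ H]

/-- The class `P_α(H)` of bounded self-adjoint operators `U` on `H` with `U ⪰ α I`, that is,
`⟨U x, x⟩ ≥ α ‖x‖²` for all `x`. -/
def IsP [CompleteSpace H] (α : ℝ) (U : H →L[ℝ] H) : Prop :=
  IsSelfAdjoint U ∧ ∀ x : H, α * ‖x‖ ^ 2 ≤ inner ℝ (U x) x

/-- The (semi-)norm `‖x‖_W = √⟨W x, x⟩` induced by the operator `W`. -/
def wnorm (W : H →L[ℝ] H) (x : H) : ℝ := √(inner ℝ (W x) x)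

/-- `p` is a point of `C` that is nearest to `y` for the norm `‖·‖_W`. -/
def IsNearest (C : Set H) (W : H →L[ℝ] H) (y p : H) : Prop :=
  p ∈ C ∧ ∀ z ∈ C, wnorm W (y - p) ≤ wnorm W (y - z)

/-- The projector `P_C^W (y) = argmin_{z ∈ C} ‖y - z‖_W`. If `C` is nonempty, closed and convex and
`W` lies in `P_δ(H)` for some `δ > 0`, then `H` being complete there is exactly one nearest point,
and this is its value. -/
def wproj (C : Set H) (W : H →L[ℝ] H) (y : H) : H :=
  Classical.epsilon (fun p => IsNearest C W y p)

/-- The set of solutions of the problem of minimizing `f` over `C`. -/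
def solutionSet (f : H → ℝ) (C : Set H) : Set H :=
  {x | x ∈ C ∧ ∀ y ∈ C, f x ≤ f y}

/-- The averagedness constant `2β / (4β - γ ‖U‖)`. -/
def avgConst (β γ : ℝ) (U : H →L[ℝ] H) : ℝ := 2 * β / (4 * β - γ * ‖U‖)

/-- Weak convergence of the sequence `x` to `p`. -/
def WeaklyConvergesTo (x : ℕ → H) (p : H) : Prop :=
  Tendsto (fun k => toWeakSpace ℝ H (x k)) atTop (𝓝 (toWeakSpace ℝ H p))

/-- An operator in `P_α(H)` with `α > 0` is invertible, so that `U.inverse` is its true inverse. -/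
theorem IsP.isInvertible [CompleteSpace H] {α : ℝ} (hα : 0 < α) {U : H →L[ℝ] H} (hU : IsP α U) :
    U.IsInvertible := by
  have h : IsUnit U := by
    refine ContinuousLinearMap.isUnit_of_forall_le_norm_inner_map U (c := ⟨α, hα.le⟩) hα ?_
    intro x
    have := hU.2 x
    have h2 := le_abs_self (inner ℝ (U x) x : ℝ)
    simp only [Real.norm_eq_abs]
    change ‖x‖ ^ 2 * α ≤ _
    linarith
  obtain ⟨u, hu⟩ := h
  exact ⟨ContinuousLinearEquiv.unitsEquiv ℝ H u, by rw [← hu]; rfl⟩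

end VarMetric

end

/-! Write T_k for `step`, the exact forward-backward map at stage k. For two points let v be the
difference of their images under T_k, w the difference of their residuals x - T_k x, and g the
difference of their gradients. The projection inequality gives ⟨U⁻¹w, v⟩ ≥ γ⟨g, v⟩, and
Baillon-Haddad gives ⟨g, v + w⟩ ≥ β‖g‖². By `slack_eq`, these two gaps, a square and ‖U‖⟨U⁻¹w, w⟩ -
‖w‖² ≥ 0 add up, with positive weights, to `slack`. Its nonnegativity is averagedness of T_k in the
metric U_k⁻¹. Solutions are fixed points of T_k, and `inner_relaxed_step` computes exactly what a
relaxed step gains towards a solution.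

Inversion reverses the operator order, so passing to the next metric costs a factor 1 + η_k, and
both perturbations a_k, b_k merge into one summable error. A Robbins-Siegmund argument then gives
convergence of the distances and summability of both λ_k(1/α_k - λ_k)‖residual‖² and λ_k·slack.

Under (A) the first sum already forces the residuals to zero. Under (B) it gives only inferior limit
zero, and the second sum does the rest. A residual of size at least ρ forces the slack above some δ
> 0 (`norm_sq_le_of_slack`), so the displacements of x_k over those indices are summable. The
inverse metrics are Cauchy in operator norm, so the residual can increase only by a small error plus
a multiple of the displacement. Large excursions are therefore excluded
(`tendsto_zero_of_controlled_increase`).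

Once the residuals vanish, weak cluster points are solutions. Opial's argument, using strong
convergence of U_k⁻¹, shows that there is only one, and cocoercivity yields strong convergence of
the gradients. -/

noncomputable section

namespace VarMetric

variable {H : Type*} [NormedAddCommGroup H] [InnerProductSpace ℝ H]

/-! ### Quadratic forms of positive operators. -/

section Seminorm

variable {W : H →L[ℝ] H}

theorem inner_nonneg_of_isPositive (hW : W.IsPositive) (x : H) : 0 ≤ inner ℝ (W x) x :=
  hW.inner_nonneg_left x

theorem inner_apply_comm (hW : W.IsPositive) (x y : H) : inner ℝ (W x) y = inner ℝ (W y) x := by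
  rw [hW.inner_left_eq_inner_right, real_inner_comm]

theorem wnorm_nonneg (W : H →L[ℝ] H) (x : H) : 0 ≤ wnorm W x := Real.sqrt_nonneg _

theorem wnorm_sq (hW : W.IsPositive) (x : H) : wnorm W x ^ 2 = inner ℝ (W x) x :=
  Real.sq_sqrt (inner_nonneg_of_isPositive hW x)

theorem inner_apply_add (hW : W.IsPositive) (x y : H) :
    inner ℝ (W (x + y)) (x + y) =
      inner ℝ (W x) x + 2 * inner ℝ (W x) y + inner ℝ (W y) y := by
  simp only [map_add, inner_add_left, inner_add_right]
  rw [inner_apply_comm hW y x]; ring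

theorem inner_apply_sub (hW : W.IsPositive) (x y : H) :
    inner ℝ (W (x - y)) (x - y) =
      inner ℝ (W x) x - 2 * inner ℝ (W x) y + inner ℝ (W y) y := by
  simp only [map_sub, inner_sub_left, inner_sub_right]
  rw [inner_apply_comm hW y x]; ring

theorem inner_apply_smul (W : H →L[ℝ] H) (t : ℝ) (x : H) :
    inner ℝ (W (t • x)) (t • x) = t ^ 2 * inner ℝ (W x) x := by
  simp only [map_smul, real_inner_smul_left, real_inner_smul_right]; ring

theorem inner_apply_sq_le (hW : W.IsPositive) (x y : H) :
    inner ℝ (W x) y ^ 2 ≤ inner ℝ (W x) x * inner ℝ (W y) y := by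
  have h : ∀ t : ℝ,
      0 ≤ inner ℝ (W y) y * (t * t) + 2 * inner ℝ (W x) y * t + inner ℝ (W x) x := by
    intro t
    have := inner_nonneg_of_isPositive hW (x + t • y)
    rw [inner_apply_add hW, inner_apply_smul, real_inner_smul_right] at this
    linarith
  have := discrim_le_zero h
  unfold discrim at this
  linarith

theorem inner_apply_le_wnorm_mul (hW : W.IsPositive) (x y : H) :
    inner ℝ (W x) y ≤ wnorm W x * wnorm W y := by
  refine le_of_sq_le_sq ?_ (mul_nonneg (wnorm_nonneg _ _) (wnorm_nonneg _ _))
  rw [mul_pow, wnorm_sq hW, wnorm_sq hW]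
  exact inner_apply_sq_le hW x y

theorem wnorm_add_le (hW : W.IsPositive) (x y : H) :
    wnorm W (x + y) ≤ wnorm W x + wnorm W y := by
  refine le_of_sq_le_sq ?_ (add_nonneg (wnorm_nonneg _ _) (wnorm_nonneg _ _))
  rw [wnorm_sq hW, inner_apply_add hW, ← wnorm_sq hW, ← wnorm_sq hW]
  nlinarith [inner_apply_le_wnorm_mul hW x y]

/-- Cauchy-Schwarz for the form of `W`, tested with y = W x. It later serves for `U`, for ‖U‖U⁻¹ - 1
and for differences of ordered operators. -/
theorem norm_apply_sq_le (hW : W.IsPositive) (x : H) :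
    ‖W x‖ ^ 2 ≤ ‖W‖ * inner ℝ (W x) x := by
  have h := inner_apply_sq_le hW x (W x)
  rw [real_inner_self_eq_norm_sq] at h
  have h2 : inner ℝ (W (W x)) (W x) ≤ ‖W‖ * ‖W x‖ ^ 2 := by
    refine (real_inner_le_norm _ _).trans ?_
    have := W.le_opNorm (W x)
    nlinarith [norm_nonneg (W x)]
  have h3 := inner_nonneg_of_isPositive hW x
  rcases eq_or_lt_of_le (sq_nonneg ‖W x‖) with h4 | h4
  · rw [← h4]; positivity
  · have : ‖W x‖ ^ 2 * ‖W x‖ ^ 2 ≤ (‖W‖ * inner ℝ (W x) x) * ‖W x‖ ^ 2 := by nlinarith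
    exact le_of_mul_le_mul_right this h4

/-- Adding the two variational inequalities gives ‖p - p'‖² ≤ ⟨y - y', p - p'⟩, which is firm
nonexpansiveness of the projection. -/
theorem norm_sub_le_of_inner_nonpos {y y' p p' : H} (h : inner ℝ (y - p) (p' - p) ≤ 0)
    (h' : inner ℝ (y' - p') (p - p') ≤ 0) : ‖p - p'‖ ≤ ‖y - y'‖ := by
  have h1 : ‖p - p'‖ ^ 2 ≤ inner ℝ (y - y') (p - p') := by
    rw [← real_inner_self_eq_norm_sq]
    have e : inner ℝ (y - p) (p' - p) = - inner ℝ (y - p) (p - p') := by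
      rw [← inner_neg_right, neg_sub]
    rw [e] at h
    have : inner ℝ (y - y') (p - p') - inner ℝ (p - p') (p - p') =
        inner ℝ (y - p) (p - p') - inner ℝ (y' - p') (p - p') := by
      rw [← inner_sub_left, ← inner_sub_left]; congr 1; abel
    linarith
  have h2 := real_inner_le_norm (y - y') (p - p')
  by_contra! h3
  nlinarith [norm_nonneg (y - y')]

theorem wnorm_sub_le_of_inner_nonpos (hW : W.IsPositive) {y y' p p' : H}
    (h : inner ℝ (W (y - p)) (p' - p) ≤ 0)
    (h' : inner ℝ (W (y' - p')) (p - p') ≤ 0) : wnorm W (p - p') ≤ wnorm W (y - y') := by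
  have h1 : wnorm W (p - p') ^ 2 ≤ inner ℝ (W (y - y')) (p - p') := by
    rw [wnorm_sq hW]
    rw [← neg_sub p p', inner_neg_right] at h
    have : inner ℝ (W (y - y')) (p - p') - inner ℝ (W (p - p')) (p - p') =
        inner ℝ (W (y - p)) (p - p') - inner ℝ (W (y' - p')) (p - p') := by
      rw [← inner_sub_left, ← inner_sub_left, ← map_sub, ← map_sub]; congr 2; abel
    linarith
  have h2 := inner_apply_le_wnorm_mul hW (y - y') (p - p')
  by_contra! h3
  nlinarith [wnorm_nonneg W (y - y')]

end Seminorm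

/-! ### The inverse metric: bounds and order reversal. -/

section Inverse

variable [CompleteSpace H] {α : ℝ} {U : H →L[ℝ] H}

theorem IsP.isPositive (hα : 0 < α) (hU : IsP α U) : U.IsPositive :=
  (ContinuousLinearMap.isPositive_iff' U).2 ⟨hU.1, fun x => le_trans (by positivity) (hU.2 x)⟩

theorem IsP.apply_inverse (hα : 0 < α) (hU : IsP α U) (x : H) : U (U.inverse x) = x :=
  (hU.isInvertible hα).self_apply_inverse x

theorem IsP.inverse_apply (hα : 0 < α) (hU : IsP α U) (x : H) : U.inverse (U x) = x :=
  (hU.isInvertible hα).inverse_apply_self x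

theorem IsP.inverse_isPositive (hα : 0 < α) (hU : IsP α U) : U.inverse.IsPositive := by
  have hp := hU.isPositive hα
  refine (ContinuousLinearMap.isPositive_iff _).2 ⟨fun x y => ?_, fun x => ?_⟩
  · have := hp.inner_left_eq_inner_right (U.inverse x) (U.inverse y)
    rw [hU.apply_inverse hα, hU.apply_inverse hα] at this
    exact this.symm
  · have := inner_nonneg_of_isPositive hp (U.inverse x)
    rwa [hU.apply_inverse hα, real_inner_comm] at this

theorem IsP.norm_inverse_apply_le (hα : 0 < α) (hU : IsP α U) (x : H) :
    ‖U.inverse x‖ ≤ ‖x‖ / α := by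
  have h := hU.2 (U.inverse x)
  rw [hU.apply_inverse hα] at h
  have h2 := real_inner_le_norm x (U.inverse x)
  rw [le_div_iff₀ hα]
  rcases eq_or_lt_of_le (norm_nonneg (U.inverse x)) with h4 | h4
  · rw [← h4]; simp
  · have : (‖U.inverse x‖ * α) * ‖U.inverse x‖ ≤ ‖x‖ * ‖U.inverse x‖ := by nlinarith
    exact le_of_mul_le_mul_right this h4

theorem IsP.inner_inverse_le (hα : 0 < α) (hU : IsP α U) (x : H) :
    inner ℝ (U.inverse x) x ≤ ‖x‖ ^ 2 / α := by
  refine (real_inner_le_norm _ _).trans ?_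
  have := hU.norm_inverse_apply_le hα x
  calc _ ≤ ‖x‖ / α * ‖x‖ := by gcongr
    _ = _ := by ring

theorem IsP.norm_sq_le (hα : 0 < α) (hU : IsP α U) (x : H) :
    ‖x‖ ^ 2 ≤ ‖U‖ * inner ℝ (U.inverse x) x := by
  have h := norm_apply_sq_le (hU.isPositive hα) (U.inverse x)
  rwa [hU.apply_inverse hα, real_inner_comm] at h

theorem IsP.wnorm_inverse_le (hα : 0 < α) (hU : IsP α U) (x : H) :
    wnorm U.inverse x ≤ ‖x‖ / √α := by
  unfold wnorm
  rw [Real.sqrt_le_left (by positivity), div_pow, Real.sq_sqrt hα.le]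
  exact hU.inner_inverse_le hα x

theorem IsP.norm_le_wnorm (hα : 0 < α) (hU : IsP α U) (x : H) :
    ‖x‖ ≤ √‖U‖ * wnorm U.inverse x := by
  unfold wnorm
  rw [← Real.sqrt_mul (norm_nonneg _)]
  exact Real.le_sqrt_of_sq_le (hU.norm_sq_le hα x)

/-- Inversion reverses the order of positive definite operators. -/
theorem IsP.inner_inverse_le_of_le {V : H →L[ℝ] H} (hα : 0 < α) (hU : IsP α U) (hV : IsP α V)
    {t : ℝ} (ht : 0 < t) (h : ∀ v, inner ℝ (U v) v ≤ t * inner ℝ (V v) v) (x : H) :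
    inner ℝ (V.inverse x) x ≤ t * inner ℝ (U.inverse x) x := by
  -- Expanding this square bounds 2t⟨V⁻¹x, x⟩ by ⟨U V⁻¹x, V⁻¹x⟩ + t²⟨U⁻¹x, x⟩, and the hypothesis
  -- bounds the first term by t⟨V⁻¹x, x⟩.
  have h1 := inner_nonneg_of_isPositive (hU.isPositive hα) (V.inverse x - t • U.inverse x)
  rw [inner_apply_sub (hU.isPositive hα), inner_apply_smul,
    inner_apply_comm (hU.isPositive hα) _ (t • _), map_smul, real_inner_smul_left,
    hU.apply_inverse hα] at h1
  have h2 := h (V.inverse x)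
  rw [hV.apply_inverse hα] at h2
  rw [real_inner_comm x (U.inverse x), real_inner_comm x (V.inverse x)] at *
  nlinarith

end Inverse

/-! ### Projection in a variable metric. -/

section Projection

variable [CompleteSpace H] {C : Set H} {W : H →L[ℝ] H}

theorem exists_inner_sub_nonpos (hne : C.Nonempty) (hcl : IsClosed C) (hcv : Convex ℝ C) (y : H) :
    ∃ p ∈ C, ∀ z ∈ C, inner ℝ (y - p) (z - p) ≤ 0 := by
  obtain ⟨p, hp, h⟩ := exists_norm_eq_iInf_of_complete_convex hne hcl.isComplete hcv y
  exact ⟨p, hp, (norm_eq_iInf_iff_real_inner_le_zero hcv hp).1 h⟩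

/-- Existence of a solution of the variational inequality that characterizes the projection onto
`C` for the metric `W`. -/
theorem exists_inner_apply_sub_nonpos (hne : C.Nonempty) (hcl : IsClosed C) (hcv : Convex ℝ C)
    {δ : ℝ} (hδ : 0 < δ) (hWδ : ∀ x, δ * ‖x‖ ^ 2 ≤ inner ℝ (W x) x) (y : H) :
    ∃ p ∈ C, ∀ z ∈ C, inner ℝ (W (y - p)) (z - p) ≤ 0 := by
  choose P hPC hP using exists_inner_sub_nonpos hne hcl hcv
  -- The solution is a fixed point of v ↦ P(v - tW(v - y)), with P the ordinary projection, as in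
  -- Lions-Stampacchia. This t makes t²‖W‖² ≤ tδ, so 1 - 2tδ + t²‖W‖² ≤ 1 - tδ < 1 and the map is a
  -- contraction.
  set t : ℝ := δ / (‖W‖ ^ 2 + 1) with ht
  have ht0 : 0 < t := by positivity
  have htW : t * ‖W‖ ^ 2 ≤ δ := by
    rw [ht, div_mul_eq_mul_div, div_le_iff₀ (by positivity)]; nlinarith [sq_nonneg ‖W‖]
  have hcontr : ∀ v : H, ‖v - t • W v‖ ≤ √(1 - t * δ) * ‖v‖ := by
    intro v
    have h1 : ‖v - t • W v‖ ^ 2 ≤ (1 - t * δ) * ‖v‖ ^ 2 := by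
      rw [norm_sub_sq_real, norm_smul, real_inner_smul_right, mul_pow, Real.norm_eq_abs, sq_abs,
        real_inner_comm]
      have h2 : ‖W v‖ ^ 2 ≤ ‖W‖ ^ 2 * ‖v‖ ^ 2 := by
        rw [← mul_pow]; gcongr; exact W.le_opNorm v
      have h3 := hWδ v
      have h4 : t ^ 2 * ‖W v‖ ^ 2 ≤ t * δ * ‖v‖ ^ 2 := by
        calc t ^ 2 * ‖W v‖ ^ 2 ≤ t ^ 2 * (‖W‖ ^ 2 * ‖v‖ ^ 2) := by gcongr
          _ = t * (t * ‖W‖ ^ 2) * ‖v‖ ^ 2 := by ring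
          _ ≤ _ := by gcongr
      nlinarith
    have h5 := Real.le_sqrt_of_sq_le h1
    rwa [Real.sqrt_mul' _ (sq_nonneg _), Real.sqrt_sq (norm_nonneg v)] at h5
  set K : NNReal := ⟨√(1 - t * δ), Real.sqrt_nonneg _⟩
  have hK : K < 1 := by
    rw [← NNReal.coe_lt_coe]
    change √(1 - t * δ) < 1
    rw [Real.sqrt_lt' one_pos]
    nlinarith [mul_pos ht0 hδ]
  have hT : ContractingWith K (fun v => P (v - t • W (v - y))) := by
    refine ⟨hK, LipschitzWith.of_dist_le_mul fun v v' => ?_⟩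
    rw [dist_eq_norm, dist_eq_norm]
    refine (norm_sub_le_of_inner_nonpos (hP _ _ (hPC _)) (hP _ _ (hPC _))).trans ?_
    refine le_trans (le_of_eq ?_) (hcontr (v - v'))
    congr 1
    simp only [map_sub, smul_sub]; abel
  have hfix := hT.fixedPoint_isFixedPt
  set p := ContractingWith.fixedPoint _ hT
  have hp : P (p - t • W (p - y)) = p := hfix
  refine ⟨p, hp ▸ hPC _, fun z hz => ?_⟩
  have h := hP (p - t • W (p - y)) z hz
  rw [hp] at h
  have e : p - t • W (p - y) - p = t • W (y - p) := by
    rw [← neg_sub y p, map_neg, smul_neg]; abel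
  rw [e, real_inner_smul_left] at h
  nlinarith

theorem inner_wproj_nonpos (hne : C.Nonempty) (hcl : IsClosed C) (hcv : Convex ℝ C)
    {δ : ℝ} (hδ : 0 < δ) (hW : W.IsPositive) (hWδ : ∀ x, δ * ‖x‖ ^ 2 ≤ inner ℝ (W x) x) (y : H) :
    wproj C W y ∈ C ∧ ∀ z ∈ C, inner ℝ (W (y - wproj C W y)) (z - wproj C W y) ≤ 0 := by
  obtain ⟨p, hp, h⟩ := exists_inner_apply_sub_nonpos hne hcl hcv hδ hWδ y
  -- This Pythagorean inequality makes `p` a nearest point and, by coercivity of `W`, the only one.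
  -- Hence the choice in `wproj` returns `p`.
  have key : ∀ z ∈ C, wnorm W (y - p) ^ 2 + inner ℝ (W (p - z)) (p - z) ≤ wnorm W (y - z) ^ 2 := by
    intro z hz
    have e : y - z = (y - p) + (p - z) := by abel
    rw [wnorm_sq hW, wnorm_sq hW, e, inner_apply_add hW]
    have := h z hz
    rw [← neg_sub p z, inner_neg_right] at this
    linarith
  have hnear : IsNearest C W y p := by
    refine ⟨hp, fun z hz => le_of_sq_le_sq ?_ (wnorm_nonneg _ _)⟩
    linarith [key z hz, inner_nonneg_of_isPositive hW (p - z)]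
  have hproj : IsNearest C W y (wproj C W y) := Classical.epsilon_spec ⟨p, hnear⟩
  have heq : p = wproj C W y := by
    have h1 := key _ hproj.1
    have h2 := hproj.2 p hp
    have h3 := hWδ (p - wproj C W y)
    have h4 : wnorm W (y - wproj C W y) ^ 2 ≤ wnorm W (y - p) ^ 2 := by
      gcongr; exact wnorm_nonneg _ _
    have h5 : ‖p - wproj C W y‖ ^ 2 ≤ 0 := by nlinarith
    have h6 : ‖p - wproj C W y‖ = 0 := by nlinarith [norm_nonneg (p - wproj C W y)]
    exact sub_eq_zero.1 (norm_eq_zero.1 h6)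
  rw [← heq]
  exact ⟨hp, h⟩

theorem IsP.inner_wproj_nonpos {α : ℝ} {U : H →L[ℝ] H} (hα : 0 < α) (hU : IsP α U)
    (hne : C.Nonempty) (hcl : IsClosed C) (hcv : Convex ℝ C) (y : H) :
    wproj C U.inverse y ∈ C ∧
      ∀ z ∈ C, inner ℝ (U.inverse (y - wproj C U.inverse y)) (z - wproj C U.inverse y) ≤ 0 := by
  have hW := hU.inverse_isPositive hα
  refine VarMetric.inner_wproj_nonpos hne hcl hcv (δ := 1 / (‖U‖ + 1)) (by positivity) hW ?_ y
  intro x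
  rw [one_div_mul_eq_div, div_le_iff₀ (by positivity)]
  linarith [hU.norm_sq_le hα x, inner_nonneg_of_isPositive hW x]

end Projection

/-! ### Convex functions with Lipschitz gradient. -/

section Convex

variable [CompleteSpace H] {f : H → ℝ}

theorem hasDerivAt_comp_line (hf : Differentiable ℝ f) (x v : H) (t : ℝ) :
    HasDerivAt (fun s : ℝ => f (x + s • v)) (inner ℝ (gradient f (x + t • v)) v) t := by
  have h1 := (hf (x + t • v)).hasGradientAt.hasFDerivAt
  have h2 : HasDerivAt (fun s : ℝ => x + s • v) v t := by
    simpa using ((hasDerivAt_id t).smul_const v).const_add x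
  have := h1.comp_hasDerivAt t h2
  rwa [InnerProductSpace.toDual_apply_apply] at this

/-- A differentiable convex function lies above its tangents. -/
theorem add_inner_gradient_le (hc : ConvexOn ℝ Set.univ f) (hf : Differentiable ℝ f) (x y : H) :
    f x + inner ℝ (gradient f x) (y - x) ≤ f y := by
  have hg : ConvexOn ℝ Set.univ (fun s : ℝ => f (x + s • (y - x))) := by
    have := hc.comp_affineMap (AffineMap.lineMap x y : ℝ →ᵃ[ℝ] H)
    simpa [Function.comp_def, AffineMap.lineMap_apply, add_comm] using this
  have h := hg.le_slope_of_hasDerivAt (Set.mem_univ 0) (Set.mem_univ 1) one_pos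
    (hasDerivAt_comp_line hf x (y - x) 0)
  simp only [slope_def_field, zero_smul, one_smul, add_zero, add_sub_cancel, sub_zero,
    div_one] at h
  linarith

/-- The descent lemma for functions with Lipschitz continuous gradient. -/
theorem le_add_inner_gradient_add (hf : Differentiable ℝ f) {L : ℝ}
    (hL : ∀ u v : H, ‖gradient f u - gradient f v‖ ≤ L * ‖u - v‖) (x y : H) :
    f y ≤ f x + inner ℝ (gradient f x) (y - x) + L / 2 * ‖y - x‖ ^ 2 := by
  set v := y - x with hv
  -- The claim is φ 1 ≤ φ 0, and the Lipschitz bound makes φ' ≤ 0 on (0, 1).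
  set φ : ℝ → ℝ := fun t => f (x + t • v) - t * inner ℝ (gradient f x) v - L / 2 * t ^ 2 * ‖v‖ ^ 2
  have hφ : ∀ t, HasDerivAt φ (inner ℝ (gradient f (x + t • v)) v - inner ℝ (gradient f x) v -
      L * t * ‖v‖ ^ 2) t := by
    intro t
    have h1 := hasDerivAt_comp_line hf x v t
    have h2 := (hasDerivAt_id t).mul_const (inner ℝ (gradient f x) v)
    have h3 := (((hasDerivAt_id t).pow 2).const_mul (L / 2)).mul_const (‖v‖ ^ 2)
    refine ((h1.sub h2).sub h3).congr_deriv ?_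
    simp only [id_eq, one_mul, Nat.cast_ofNat, Nat.add_one_sub_one, pow_one, mul_one]; ring
  have hanti : AntitoneOn φ (Set.Icc 0 1) := by
    refine antitoneOn_of_deriv_nonpos (convex_Icc 0 1)
      (fun t _ => (hφ t).continuousAt.continuousWithinAt)
      (fun t _ => (hφ t).differentiableAt.differentiableWithinAt) fun t ht => ?_
    rw [interior_Icc] at ht
    rw [(hφ t).deriv, ← inner_sub_left]
    have h1 := real_inner_le_norm (gradient f (x + t • v) - gradient f x) v
    have h2 := hL (x + t • v) x
    rw [add_sub_cancel_left, norm_smul, Real.norm_eq_abs, abs_of_pos ht.1] at h2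
    nlinarith [norm_nonneg v]
  have h := hanti (Set.left_mem_Icc.2 zero_le_one) (Set.right_mem_Icc.2 zero_le_one) zero_le_one
  simp only [φ, one_smul, zero_smul, add_zero, hv] at h
  rw [add_sub_cancel, ← hv] at h
  linarith

/-- The theorem of Baillon and Haddad: the gradient of a convex function with `L`-Lipschitz gradient
is `1 / L`-cocoercive. -/
theorem gradient_cocoercive (hc : ConvexOn ℝ Set.univ f) (hf : Differentiable ℝ f) {L : ℝ}
    (hL0 : 0 < L) (hL : ∀ u v : H, ‖gradient f u - gradient f v‖ ≤ L * ‖u - v‖) (x y : H) :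
    1 / L * ‖gradient f x - gradient f y‖ ^ 2 ≤
      inner ℝ (gradient f x - gradient f y) (x - y) := by
  -- The tangent at x and the quadratic upper bound at y are compared at z = y - (∇f y - ∇f x)/L,
  -- which minimizes that upper bound minus ⟨∇f x, ·⟩. Adding the resulting inequality to its copy
  -- with x and y swapped gives cocoercivity.
  have key : ∀ x y : H, f x + inner ℝ (gradient f x) (y - x) +
      1 / (2 * L) * ‖gradient f y - gradient f x‖ ^ 2 ≤ f y := by
    intro x y
    set d := gradient f y - gradient f x with hd
    set z := y - (1 / L) • d with hz
    have h1 := add_inner_gradient_le hc hf x z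
    have h2 := le_add_inner_gradient_add hf hL y z
    have e1 : z - y = -((1 / L) • d) := by rw [hz]; abel
    have e2 : z - x = (y - x) - (1 / L) • d := by rw [hz]; abel
    rw [e1, inner_neg_right, norm_neg, norm_smul, real_inner_smul_right, mul_pow,
      Real.norm_eq_abs, sq_abs] at h2
    rw [e2, inner_sub_right, real_inner_smul_right] at h1
    have e3 : inner ℝ (gradient f y) d - inner ℝ (gradient f x) d = ‖d‖ ^ 2 := by
      rw [← inner_sub_left, ← hd, real_inner_self_eq_norm_sq]
    have e4 : L / 2 * ((1 / L) ^ 2 * ‖d‖ ^ 2) = 1 / (2 * L) * ‖d‖ ^ 2 := by field_simp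
    have e5 : 1 / L * inner ℝ (gradient f y) d = 1 / L * inner ℝ (gradient f x) d +
        2 * (1 / (2 * L) * ‖d‖ ^ 2) := by
      rw [← e3]; field_simp; ring
    linarith
  have h1 := key x y
  have h2 := key y x
  rw [norm_sub_rev] at h1
  have e : inner ℝ (gradient f x - gradient f y) (x - y) =
      - inner ℝ (gradient f x) (y - x) - inner ℝ (gradient f y) (x - y) := by
    rw [← inner_neg_right, neg_sub, inner_sub_left]
  rw [e]
  have e6 : 1 / L * ‖gradient f x - gradient f y‖ ^ 2 =
      2 * (1 / (2 * L) * ‖gradient f x - gradient f y‖ ^ 2) := by field_simp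
  linarith

/-- The first-order optimality condition for minimizers over a convex set. -/
theorem inner_gradient_nonneg_of_mem_solutionSet (hf : Differentiable ℝ f) {C : Set H}
    (hC : Convex ℝ C) {z c : H} (hz : z ∈ solutionSet f C) (hcC : c ∈ C) :
    0 ≤ inner ℝ (gradient f z) (c - z) := by
  have hmin : IsLocalMinOn f C z := IsMinOn.localize fun y hy => hz.2 y hy
  have h := hmin.hasFDerivWithinAt_nonneg (hf z).hasGradientAt.hasFDerivAt.hasFDerivWithinAt
    (sub_mem_posTangentConeAt_of_segment_subset (hC.segment_subset hz.1 hcC))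
  simpa using h

end Convex

/-! ### The slack of the forward-backward inequality. -/

section Slack

variable {α β γ : ℝ} {U : H →L[ℝ] H}

/-- The excess by which the forward-backward step is better than averaged: `v` is the difference of
two steps and `w` the difference of the two residuals. -/
def slack (β γ : ℝ) (U : H →L[ℝ] H) (w v : H) : ℝ :=
  2 * inner ℝ (U.inverse w) v + γ * ‖U‖ / (2 * β) * inner ℝ (U.inverse w) w

/-- The vector `g` cancels from the right-hand side. With `g` the gradient difference, the four
terms are the gaps in the projection inequality and in cocoercivity, a square, and the gap in ‖U‖U⁻¹
⪰ 1. -/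
theorem slack_eq (hβ : 0 < β) (w v g : H) :
    slack β γ U w v = 2 * (inner ℝ (U.inverse w) v - γ * inner ℝ g v) +
      2 * γ * (inner ℝ g (v + w) - β * ‖g‖ ^ 2) + 2 * γ * β * ‖g - (1 / (2 * β)) • w‖ ^ 2 +
      γ / (2 * β) * (‖U‖ * inner ℝ (U.inverse w) w - ‖w‖ ^ 2) := by
  rw [norm_sub_sq_real, norm_smul, real_inner_smul_right, mul_pow, Real.norm_eq_abs, sq_abs,
    inner_add_right, slack]
  field_simp
  ring

theorem slack_nonneg [CompleteSpace H] (hα : 0 < α) (hU : IsP α U) (hβ : 0 < β) (hγ : 0 < γ)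
    {w v g : H} (hA : γ * inner ℝ g v ≤ inner ℝ (U.inverse w) v)
    (hB : β * ‖g‖ ^ 2 ≤ inner ℝ g (v + w)) :
    0 ≤ slack β γ U w v := by
  rw [slack_eq hβ w v g]
  have h1 := sub_nonneg.2 hA
  have h2 := sub_nonneg.2 hB
  have h3 := sub_nonneg.2 (hU.norm_sq_le hα w)
  positivity

/-- Here v + w is the difference of the inputs. Being an identity, it retains the slack as a second
source of summability next to the averagedness term. -/
theorem inner_relaxed (hW : U.inverse.IsPositive) (w v : H) (t : ℝ) :
    inner ℝ (U.inverse (v + w - t • w)) (v + w - t • w) =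
      inner ℝ (U.inverse (v + w)) (v + w) -
        t * (2 - γ * ‖U‖ / (2 * β) - t) * inner ℝ (U.inverse w) w - t * slack β γ U w v := by
  rw [inner_apply_sub hW, inner_apply_smul, real_inner_smul_right, slack, inner_apply_add hW,
    map_add, inner_add_left, inner_apply_comm hW v w]
  ring

/-- The operator J = ‖U‖U⁻¹ - 1 is positive of norm at most μ/α + 1, so `norm_apply_sq_le` applies
to it. -/
theorem IsP.norm_smul_inverse_sub_sq_le [CompleteSpace H] (hα : 0 < α) (hU : IsP α U) {μ : ℝ}
    (hμ : ‖U‖ ≤ μ) (w : H) :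
    ‖‖U‖ • U.inverse w - w‖ ^ 2 ≤
      (μ / α + 1) * (‖U‖ * inner ℝ (U.inverse w) w - ‖w‖ ^ 2) := by
  have hμ0 : 0 ≤ μ := (norm_nonneg U).trans hμ
  have hW := hU.inverse_isPositive hα
  set J : H →L[ℝ] H := ‖U‖ • U.inverse - 1 with hJ
  have hJa : ∀ x, J x = ‖U‖ • U.inverse x - x := fun x => rfl
  have hJi : ∀ x, inner ℝ (J x) x = ‖U‖ * inner ℝ (U.inverse x) x - ‖x‖ ^ 2 := by
    intro x
    rw [hJa, inner_sub_left, real_inner_smul_left, real_inner_self_eq_norm_sq]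
  have hJp : J.IsPositive := by
    refine (ContinuousLinearMap.isPositive_iff _).2 ⟨fun x y => ?_, fun x => ?_⟩
    · have := hW.inner_left_eq_inner_right x y
      change inner ℝ (‖U‖ • U.inverse x - x) y = inner ℝ x (‖U‖ • U.inverse y - y)
      rw [inner_sub_left, inner_sub_right, real_inner_smul_left, real_inner_smul_right, this]
    · rw [hJi]
      linarith [hU.norm_sq_le hα x]
  have hJn : ‖J‖ ≤ μ / α + 1 := by
    refine J.opNorm_le_bound (by positivity) fun x => ?_
    have h1 := hU.norm_inverse_apply_le hα x
    calc ‖J x‖ ≤ ‖‖U‖ • U.inverse x‖ + ‖x‖ := norm_sub_le _ _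
      _ ≤ μ * (‖x‖ / α) + ‖x‖ := by rw [norm_smul, norm_norm]; gcongr
      _ = _ := by ring
  rw [← hJa, ← hJi]
  refine (norm_apply_sq_le hJp w).trans ?_
  gcongr
  exact inner_nonneg_of_isPositive hJp w

/-- The constant in the bound of the residual by the slack. -/
def slackConst (α β γ₀ μ M θ : ℝ) : ℝ :=
  4 * β * (1 / (2 * γ₀) + √(1 / (2 * γ₀ * β)) * M + β * (1 / (2 * γ₀ * β))) +
    2 * ((√((μ / α + 1) * (2 * β / γ₀)) + 2 * β * √(1 / (2 * γ₀ * β))) * M / θ)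

/-- The residual is controlled by the slack. -/
theorem norm_sq_le_of_slack [CompleteSpace H] (hα : 0 < α) (hU : IsP α U) (hβ : 0 < β) {w v g : H}
    (hA : γ * inner ℝ g v ≤ inner ℝ (U.inverse w) v) (hB : β * ‖g‖ ^ 2 ≤ inner ℝ g (v + w))
    {γ₀ μ M θ : ℝ} (hγ₀ : 0 < γ₀) (hγ : γ₀ ≤ γ) (hμ : ‖U‖ ≤ μ) (hM : ‖v‖ ≤ M) (hθ : 0 < θ)
    (hc : γ * ‖U‖ ≤ (1 - θ) * (2 * β)) (hS : slack β γ U w v ≤ 1) :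
    ‖w‖ ^ 2 ≤ slackConst α β γ₀ μ M θ * √(slack β γ U w v) := by
  unfold slackConst
  have hγ' : 0 < γ := hγ₀.trans_le hγ
  have hS0 := slack_nonneg hα hU hβ hγ' hA hB
  have hSeq := slack_eq (γ := γ) (U := U) hβ w v g
  have hM0 : 0 ≤ M := (norm_nonneg v).trans hM
  have hμ0 : 0 ≤ μ := (norm_nonneg U).trans hμ
  set S := slack β γ U w v
  set s := √S
  have hs0 : 0 ≤ s := Real.sqrt_nonneg _
  have hss : s ^ 2 = S := Real.sq_sqrt hS0
  -- As S ≤ 1, bounds linear in S can be weakened to bounds in √S, the common scale of the estimate.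
  have hs1 : S ≤ s := by
    have : s ≤ 1 := Real.sqrt_le_one.2 hS
    nlinarith
  set A := inner ℝ (U.inverse w) v - γ * inner ℝ g v with hAdef
  set B := inner ℝ g (v + w) - β * ‖g‖ ^ 2 with hBdef
  set h := g - (1 / (2 * β)) • w with hh
  set q := ‖U‖ * inner ℝ (U.inverse w) w - ‖w‖ ^ 2 with hq
  have hA0 : 0 ≤ A := sub_nonneg.2 hA
  have hB0 : 0 ≤ B := sub_nonneg.2 hB
  have hq0 : 0 ≤ q := sub_nonneg.2 (hU.norm_sq_le hα w)
  have hBq : 0 ≤ 2 * γ * B := by positivity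
  have hhq : 0 ≤ 2 * γ * β * ‖h‖ ^ 2 := by positivity
  have hqq : 0 ≤ γ / (2 * β) * q := by positivity
  have hBle : B ≤ 1 / (2 * γ₀) * s := by
    rw [one_div_mul_eq_div, le_div_iff₀ (by positivity)]
    nlinarith
  have hhle2 : ‖h‖ ^ 2 ≤ 1 / (2 * γ₀ * β) * S := by
    rw [one_div_mul_eq_div, le_div_iff₀ (by positivity)]
    have : 2 * γ₀ * β * ‖h‖ ^ 2 ≤ 2 * γ * β * ‖h‖ ^ 2 := by gcongr
    linarith
  have hhle : ‖h‖ ≤ √(1 / (2 * γ₀ * β)) * s := by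
    rw [← Real.sqrt_mul (by positivity)]
    exact Real.le_sqrt_of_sq_le hhle2
  have hqle : q ≤ 2 * β / γ₀ * S := by
    rw [div_mul_eq_mul_div, le_div_iff₀ (by positivity)]
    have h1 : γ₀ / (2 * β) * q ≤ S := by
      have : γ₀ / (2 * β) * q ≤ γ / (2 * β) * q := by gcongr
      linarith
    rw [div_mul_eq_mul_div, div_le_iff₀ (by positivity)] at h1
    linarith
  set j := ‖U‖ • U.inverse w - w with hj
  have hjle : ‖j‖ ≤ √((μ / α + 1) * (2 * β / γ₀)) * s := by
    rw [← Real.sqrt_mul (by positivity)]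
    refine Real.le_sqrt_of_sq_le ((hU.norm_smul_inverse_sub_sq_le hα hμ w).trans ?_)
    calc (μ / α + 1) * q ≤ (μ / α + 1) * (2 * β / γ₀ * S) := by gcongr
      _ = _ := by ring
  have hhv : - inner ℝ h v ≤ √(1 / (2 * γ₀ * β)) * M * s := by
    have h1 := (abs_le.1 (abs_real_inner_le_norm h v)).1
    have h2 : ‖h‖ * ‖v‖ ≤ √(1 / (2 * γ₀ * β)) * s * M := by gcongr
    linarith
  -- From A ≥ 0 and the identity `e` below, (2β - γ‖U‖)⟨w, v⟩ is bounded below by terms in `h` and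
  -- `j`, both O(√S). Dividing by the coefficient needs γ‖U‖ to stay away from 2β, which is the role
  -- of θ.
  have hwv : - inner ℝ w v ≤
      (√((μ / α + 1) * (2 * β / γ₀)) + 2 * β * √(1 / (2 * γ₀ * β))) * M / θ * s := by
    rcases le_or_gt 0 (inner ℝ w v) with h0 | h0
    · exact (neg_nonpos.2 h0).trans (by positivity)
    have e : 2 * β * (‖U‖ * A) = (2 * β - γ * ‖U‖) * inner ℝ w v +
        2 * β * inner ℝ j v - 2 * β * (γ * ‖U‖) * inner ℝ h v := by
      rw [hAdef, hj, hh]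
      simp only [inner_sub_left, real_inner_smul_left]
      field_simp
      ring
    have h1 := (real_inner_le_norm j v)
    have h2 := (abs_le.1 (abs_real_inner_le_norm h v)).1
    have h3 : 0 ≤ 2 * β * (‖U‖ * A) := by positivity
    have h4 : γ * ‖U‖ ≤ 2 * β := by linarith [mul_pos hθ hβ]
    have h5 : 2 * β * (γ * ‖U‖) * (- inner ℝ h v) ≤ 2 * β * (2 * β) * (‖h‖ * ‖v‖) := by
      refine (mul_le_mul_of_nonneg_left (neg_le.1 h2) (by positivity)).trans ?_
      gcongr
    have h6 : θ * (2 * β) * (- inner ℝ w v) ≤ (2 * β - γ * ‖U‖) * (- inner ℝ w v) :=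
      mul_le_mul_of_nonneg_right (by linarith) (by linarith)
    have h1' : 2 * β * inner ℝ j v ≤ 2 * β * (‖j‖ * ‖v‖) := by gcongr
    have h7 : 2 * β * (θ * (- inner ℝ w v)) ≤ 2 * β * ((‖j‖ + 2 * β * ‖h‖) * ‖v‖) := by
      linarith
    have h8 : θ * (- inner ℝ w v) ≤ (‖j‖ + 2 * β * ‖h‖) * ‖v‖ :=
      le_of_mul_le_mul_left h7 (by positivity)
    rw [div_mul_eq_mul_div, le_div_iff₀ hθ]
    calc - inner ℝ w v * θ ≤ (‖j‖ + 2 * β * ‖h‖) * ‖v‖ := by linarith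
      _ ≤ (√((μ / α + 1) * (2 * β / γ₀)) * s + 2 * β * (√(1 / (2 * γ₀ * β)) * s)) * M := by
        gcongr
      _ = _ := by ring
  have hhle3 : ‖h‖ ^ 2 ≤ 1 / (2 * γ₀ * β) * s := hhle2.trans (by gcongr)
  -- Substituting g = h + w/(2β) in B and solving for ‖w‖² leaves only quantities estimated above.
  have e : ‖w‖ ^ 2 = 4 * β * (B - inner ℝ h v + β * ‖h‖ ^ 2) + 2 * (- inner ℝ w v) := by
    rw [hBdef, hh, norm_sub_sq_real, norm_smul, real_inner_smul_right, mul_pow, Real.norm_eq_abs,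
      sq_abs, inner_add_right, inner_sub_left, real_inner_smul_left]
    field_simp
    ring
  rw [e]
  clear_value s S A B h q j
  calc _ ≤ 4 * β * (1 / (2 * γ₀) * s + √(1 / (2 * γ₀ * β)) * M * s +
        β * (1 / (2 * γ₀ * β) * s)) +
      2 * ((√((μ / α + 1) * (2 * β / γ₀)) + 2 * β * √(1 / (2 * γ₀ * β))) * M / θ * s) := by
        gcongr
        linarith
    _ = _ := by ring

end Slack

/-! ### The forward-backward step. -/

section Step

variable [CompleteSpace H]

/-- The forward-backward step `P_C^{U⁻¹} (x - γ U ∇f(x))`. -/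
def step (C : Set H) (f : H → ℝ) (U : H →L[ℝ] H) (γ : ℝ) (x : H) : H :=
  wproj C U.inverse (x - γ • U (gradient f x))

/-- The standing assumptions on the minimization problem and on the metrics and step sizes. -/
structure Setting (C : Set H) (f : H → ℝ) (α β μ : ℝ) (U : ℕ → H →L[ℝ] H) (γ : ℕ → ℝ) : Prop where
  isClosed : IsClosed C
  convex : Convex ℝ C
  nonempty : C.Nonempty
  convexOn : ConvexOn ℝ Set.univ f
  differentiable : Differentiable ℝ f
  β_pos : 0 < β
  cocoercive : ∀ x y, β * ‖gradient f x - gradient f y‖ ^ 2 ≤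
    inner ℝ (gradient f x - gradient f y) (x - y)
  α_pos : 0 < α
  isP : ∀ k, IsP α (U k)
  norm_le : ∀ k, ‖U k‖ ≤ μ
  γ_pos : ∀ k, 0 < γ k
  γ_lt : ∀ k, γ k * ‖U k‖ < 2 * β

namespace Setting

variable {C : Set H} {f : H → ℝ} {α β μ : ℝ} {U : ℕ → H →L[ℝ] H} {γ : ℕ → ℝ}

theorem μ_nonneg (h : Setting C f α β μ U γ) : 0 ≤ μ := (norm_nonneg _).trans (h.norm_le 0)

theorem isPositive (h : Setting C f α β μ U γ) (k : ℕ) : (U k).inverse.IsPositive :=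
  (h.isP k).inverse_isPositive h.α_pos

theorem norm_sq_le (h : Setting C f α β μ U γ) (k : ℕ) (v : H) :
    ‖v‖ ^ 2 ≤ μ * inner ℝ ((U k).inverse v) v := by
  refine ((h.isP k).norm_sq_le h.α_pos v).trans ?_
  have := inner_nonneg_of_isPositive (h.isPositive k) v
  gcongr
  exact h.norm_le k

theorem norm_le_wnorm (h : Setting C f α β μ U γ) (k : ℕ) (v : H) :
    ‖v‖ ≤ √μ * wnorm (U k).inverse v := by
  refine ((h.isP k).norm_le_wnorm h.α_pos v).trans ?_
  have := wnorm_nonneg (U k).inverse v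
  gcongr
  exact h.norm_le k

theorem wnorm_le (h : Setting C f α β μ U γ) (k : ℕ) (v : H) :
    wnorm (U k).inverse v ≤ ‖v‖ / √α := (h.isP k).wnorm_inverse_le h.α_pos v

theorem norm_gradient_sub_le (h : Setting C f α β μ U γ) (x y : H) :
    ‖gradient f x - gradient f y‖ ≤ ‖x - y‖ / β := by
  rw [le_div_iff₀ h.β_pos]
  have h1 := h.cocoercive x y
  have h2 := real_inner_le_norm (gradient f x - gradient f y) (x - y)
  rcases eq_or_lt_of_le (norm_nonneg (gradient f x - gradient f y)) with h4 | h4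
  · rw [← h4]; simp
  · have : ‖gradient f x - gradient f y‖ * (‖gradient f x - gradient f y‖ * β) ≤
        ‖gradient f x - gradient f y‖ * ‖x - y‖ := by linarith
    exact le_of_mul_le_mul_left this h4

theorem step_mem (h : Setting C f α β μ U γ) (k : ℕ) (x : H) : step C f (U k) (γ k) x ∈ C :=
  ((h.isP k).inner_wproj_nonpos h.α_pos h.nonempty h.isClosed h.convex _).1

theorem inner_step_le (h : Setting C f α β μ U γ) (k : ℕ) (x : H) {z : H} (hz : z ∈ C) :
    inner ℝ ((U k).inverse (x - step C f (U k) (γ k) x)) (z - step C f (U k) (γ k) x) ≤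
      γ k * inner ℝ (gradient f x) (z - step C f (U k) (γ k) x) := by
  have h1 := ((h.isP k).inner_wproj_nonpos h.α_pos h.nonempty h.isClosed h.convex
    (x - γ k • U k (gradient f x))).2 z hz
  change inner ℝ ((U k).inverse (x - γ k • U k (gradient f x) - step C f (U k) (γ k) x))
    (z - step C f (U k) (γ k) x) ≤ 0 at h1
  rw [sub_right_comm, map_sub, map_smul, (h.isP k).inverse_apply h.α_pos, inner_sub_left,
    real_inner_smul_left] at h1
  linarith

/-- Testing the projection inequality with z itself gives ⟨U⁻¹(z - p), z - p⟩ ≤ γ⟨∇f z, z - p⟩, and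
first-order optimality makes the right side nonpositive. -/
theorem step_eq_self (h : Setting C f α β μ U γ) (k : ℕ) {z : H} (hz : z ∈ solutionSet f C) :
    step C f (U k) (γ k) z = z := by
  set p := step C f (U k) (γ k) z
  have h1 : inner ℝ ((U k).inverse (z - p)) (z - p) ≤ γ k * inner ℝ (gradient f z) (z - p) :=
    h.inner_step_le k z hz.1
  have h2 : 0 ≤ inner ℝ (gradient f z) (p - z) :=
    inner_gradient_nonneg_of_mem_solutionSet h.differentiable h.convex hz (h.step_mem k z)
  have h3 : inner ℝ ((U k).inverse (z - p)) (z - p) ≤ 0 := by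
    refine h1.trans (mul_nonpos_of_nonneg_of_nonpos (h.γ_pos k).le ?_)
    rw [← neg_sub p z, inner_neg_right]
    linarith
  have h4 : ‖z - p‖ ^ 2 ≤ 0 :=
    (h.norm_sq_le k _).trans (mul_nonpos_of_nonneg_of_nonpos h.μ_nonneg h3)
  have h5 : ‖z - p‖ = 0 := by nlinarith [norm_nonneg (z - p)]
  exact (sub_eq_zero.1 (norm_eq_zero.1 h5)).symm

theorem inner_gradient_sub_step_sub_le (h : Setting C f α β μ U γ) (k : ℕ) (x y : H) :
    γ k * inner ℝ (gradient f x - gradient f y)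
        (step C f (U k) (γ k) x - step C f (U k) (γ k) y) ≤
      inner ℝ ((U k).inverse (x - step C f (U k) (γ k) x - (y - step C f (U k) (γ k) y)))
        (step C f (U k) (γ k) x - step C f (U k) (γ k) y) := by
  have h1 := h.inner_step_le k x (h.step_mem k y)
  have h2 := h.inner_step_le k y (h.step_mem k x)
  rw [← neg_sub (step C f (U k) (γ k) x) (step C f (U k) (γ k) y), inner_neg_right,
    inner_neg_right] at h1
  rw [map_sub, inner_sub_left, inner_sub_left]
  linarith

theorem cocoercive_add (h : Setting C f α β μ U γ) (k : ℕ) (x y : H) :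
    β * ‖gradient f x - gradient f y‖ ^ 2 ≤
      inner ℝ (gradient f x - gradient f y) (step C f (U k) (γ k) x - step C f (U k) (γ k) y +
        (x - step C f (U k) (γ k) x - (y - step C f (U k) (γ k) y))) := by
  convert h.cocoercive x y using 2
  abel

theorem slack_step_nonneg (h : Setting C f α β μ U γ) (k : ℕ) (x y : H) :
    0 ≤ slack β (γ k) (U k) (x - step C f (U k) (γ k) x - (y - step C f (U k) (γ k) y))
      (step C f (U k) (γ k) x - step C f (U k) (γ k) y) :=
  slack_nonneg h.α_pos (h.isP k) h.β_pos (h.γ_pos k)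
    (h.inner_gradient_sub_step_sub_le k x y) (h.cocoercive_add k x y)

/-- The difference of the squared norms is 2⟨U⁻¹w, v⟩ + ⟨U⁻¹w, w⟩, which dominates the slack because
γ‖U‖ ≤ 2β. -/
theorem wnorm_step_sub_le (h : Setting C f α β μ U γ) (k : ℕ) (x y : H) :
    wnorm (U k).inverse (step C f (U k) (γ k) x - step C f (U k) (γ k) y) ≤
      wnorm (U k).inverse (x - y) := by
  have h1 := h.slack_step_nonneg k x y
  set v := step C f (U k) (γ k) x - step C f (U k) (γ k) y with hv
  set w := x - step C f (U k) (γ k) x - (y - step C f (U k) (γ k) y) with hw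
  have e : x - y = v + w := by rw [hv, hw]; abel
  refine le_of_sq_le_sq ?_ (wnorm_nonneg _ _)
  rw [wnorm_sq (h.isPositive k), wnorm_sq (h.isPositive k), e, inner_apply_add (h.isPositive k),
    inner_apply_comm (h.isPositive k) v w]
  rw [slack] at h1
  have h2 : γ k * ‖U k‖ / (2 * β) * inner ℝ ((U k).inverse w) w ≤
      1 * inner ℝ ((U k).inverse w) w := by
    have := inner_nonneg_of_isPositive (h.isPositive k) w
    gcongr
    rw [div_le_one (by linarith [h.β_pos])]
    exact (h.γ_lt k).le
  linarith

theorem norm_step_sub_le (h : Setting C f α β μ U γ) (k : ℕ) (x y : H) :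
    ‖step C f (U k) (γ k) x - step C f (U k) (γ k) y‖ ≤ √μ / √α * ‖x - y‖ := by
  calc _ ≤ √μ * wnorm (U k).inverse (step C f (U k) (γ k) x - step C f (U k) (γ k) y) :=
        h.norm_le_wnorm k _
    _ ≤ √μ * (‖x - y‖ / √α) := by
        gcongr
        exact (h.wnorm_step_sub_le k x y).trans (h.wnorm_le k _)
    _ = _ := by ring

/-- Dependence of the step on the metric and on the step size. -/
theorem norm_step_sub_step_le (h : Setting C f α β μ U γ) (m n : ℕ) (x : H) :
    ‖step C f (U n) (γ n) x - step C f (U m) (γ m) x‖ ≤ μ * (|γ n - γ m| * ‖gradient f x‖ +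
      ‖(U n).inverse - (U m).inverse‖ * ‖x - step C f (U m) (γ m) x‖) := by
  set p := step C f (U m) (γ m) x
  set q := step C f (U n) (γ n) x
  have h1 : inner ℝ ((U m).inverse (x - p)) (q - p) ≤ γ m * inner ℝ (gradient f x) (q - p) :=
    h.inner_step_le m x (h.step_mem n x)
  have h2 : inner ℝ ((U n).inverse (x - q)) (p - q) ≤ γ n * inner ℝ (gradient f x) (p - q) :=
    h.inner_step_le n x (h.step_mem m x)
  rw [← neg_sub q p, inner_neg_right, inner_neg_right] at h2
  -- The two variational inequalities, one per metric, are added; only the change of metric and the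
  -- change of step size remain.
  have e : inner ℝ ((U n).inverse (q - p)) (q - p) =
      inner ℝ (((U n).inverse - (U m).inverse) (x - p)) (q - p) +
      inner ℝ ((U m).inverse (x - p)) (q - p) - inner ℝ ((U n).inverse (x - q)) (q - p) := by
    rw [← inner_add_left, ← inner_sub_left]
    congr 1
    change _ = (U n).inverse (x - p) - (U m).inverse (x - p) + (U m).inverse (x - p) - _
    rw [sub_add_cancel, ← map_sub]
    congr 1; abel
  have h3 : inner ℝ (((U n).inverse - (U m).inverse) (x - p)) (q - p) ≤
      ‖(U n).inverse - (U m).inverse‖ * ‖x - p‖ * ‖q - p‖ := by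
    refine (real_inner_le_norm _ _).trans ?_
    gcongr
    exact ContinuousLinearMap.le_opNorm _ _
  have h4 : (γ m - γ n) * inner ℝ (gradient f x) (q - p) ≤
      |γ n - γ m| * (‖gradient f x‖ * ‖q - p‖) := by
    refine (le_abs_self _).trans ?_
    rw [abs_mul, abs_sub_comm]
    gcongr
    exact abs_real_inner_le_norm _ _
  have h5 : inner ℝ ((U n).inverse (q - p)) (q - p) ≤ (|γ n - γ m| * ‖gradient f x‖ +
      ‖(U n).inverse - (U m).inverse‖ * ‖x - p‖) * ‖q - p‖ := by linarith
  have h6 : ‖q - p‖ ^ 2 ≤ μ * ((|γ n - γ m| * ‖gradient f x‖ +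
      ‖(U n).inverse - (U m).inverse‖ * ‖x - p‖) * ‖q - p‖) :=
    (h.norm_sq_le n _).trans (mul_le_mul_of_nonneg_left h5 h.μ_nonneg)
  rcases eq_or_lt_of_le (norm_nonneg (q - p)) with h7 | h7
  · rw [← h7]
    have := h.μ_nonneg
    positivity
  · refine le_of_mul_le_mul_right (?_ : _ * ‖q - p‖ ≤ _) h7
    linarith

theorem one_div_avgConst (h : Setting C f α β μ U γ) (k : ℕ) :
    1 / avgConst β (γ k) (U k) = 2 - γ k * ‖U k‖ / (2 * β) := by
  have := h.β_pos
  rw [avgConst, one_div_div]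
  field_simp
  ring

/-- The effect of a relaxed exact step on the distance to a given point. -/
theorem inner_relaxed_step (h : Setting C f α β μ U γ) (k : ℕ) (z : H) (t : ℝ) (x : H) :
    wnorm (U k).inverse (x + t • (step C f (U k) (γ k) x - x) - z) ^ 2 =
      wnorm (U k).inverse (x - z) ^ 2 - t * (1 / avgConst β (γ k) (U k) - t) *
        wnorm (U k).inverse (x - step C f (U k) (γ k) x) ^ 2 -
      t * slack β (γ k) (U k) (x - step C f (U k) (γ k) x) (step C f (U k) (γ k) x - z) := by
  set p := step C f (U k) (γ k) x
  have e := inner_relaxed (β := β) (γ := γ k) (h.isPositive k) (x - p) (p - z) t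
  have e1 : x + t • (p - x) - z = p - z + (x - p) - t • (x - p) := by
    rw [← neg_sub x p, smul_neg]; abel
  have e2 : x - z = p - z + (x - p) := by abel
  rw [wnorm_sq (h.isPositive k), wnorm_sq (h.isPositive k), wnorm_sq (h.isPositive k),
    h.one_div_avgConst, e1, e2]
  exact e

theorem slack_nonneg_of_mem (h : Setting C f α β μ U γ) (k : ℕ) {z : H}
    (hz : z ∈ solutionSet f C) (x : H) :
    0 ≤ slack β (γ k) (U k) (x - step C f (U k) (γ k) x) (step C f (U k) (γ k) x - z) := by
  have := h.slack_step_nonneg k x z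
  rwa [h.step_eq_self k hz, sub_self, sub_zero] at this

end Setting

end Step

/-! ### Almost monotone sequences. -/

/-- A deterministic form of the Robbins-Siegmund lemma. -/
theorem exists_tendsto_and_summable {r s η δ : ℕ → ℝ} (hr : ∀ k, 0 ≤ r k) (hs : ∀ k, 0 ≤ s k)
    (hη : ∀ k, 0 ≤ η k) (hδ : ∀ k, 0 ≤ δ k) (hη_sum : Summable η) (hδ_sum : Summable δ)
    (h : ∀ k, r (k + 1) ≤ (1 + η k) * r k - s k + δ k) :
    (∃ l, Tendsto r atTop (𝓝 l)) ∧ Summable s := by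
  have hb : ∀ k, r k ≤ Real.exp (∑ i ∈ Finset.range k, η i) *
      (r 0 + ∑ i ∈ Finset.range k, δ i) := by
    intro k
    induction k with
    | zero => simp
    | succ k ih =>
      rw [Finset.sum_range_succ, Finset.sum_range_succ, Real.exp_add]
      have h1 : 1 + η k ≤ Real.exp (η k) := by linarith [Real.add_one_le_exp (η k)]
      have h2 : 1 ≤ Real.exp (∑ i ∈ Finset.range k, η i) * Real.exp (η k) := by
        rw [← Real.exp_add]
        exact Real.one_le_exp (add_nonneg (Finset.sum_nonneg fun i _ => hη i) (hη k))
      calc r (k + 1) ≤ (1 + η k) * r k + δ k := by linarith [h k, hs k]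
        _ ≤ Real.exp (η k) * (Real.exp (∑ i ∈ Finset.range k, η i) *
            (r 0 + ∑ i ∈ Finset.range k, δ i)) +
            (Real.exp (∑ i ∈ Finset.range k, η i) * Real.exp (η k)) * δ k :=
          add_le_add (mul_le_mul h1 ih (hr k) (Real.exp_nonneg _))
            (le_mul_of_one_le_left (hδ k) h2)
        _ = _ := by ring
  obtain ⟨M, hM⟩ : ∃ M, ∀ k, r k ≤ M := by
    refine ⟨Real.exp (∑' i, η i) * (r 0 + ∑' i, δ i), fun k => (hb k).trans ?_⟩
    have h1 := hη_sum.sum_le_tsum (Finset.range k) fun i _ => hη i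
    have h2 := hδ_sum.sum_le_tsum (Finset.range k) fun i _ => hδ i
    have h3 : 0 ≤ ∑ i ∈ Finset.range k, δ i := Finset.sum_nonneg fun i _ => hδ i
    have := hr 0
    gcongr
  have hM0 : 0 ≤ M := (hr 0).trans (hM 0)
  have he_sum : Summable fun k => M * η k + δ k := (hη_sum.mul_left M).add hδ_sum
  have he0 : ∀ k, 0 ≤ M * η k + δ k := fun k => add_nonneg (mul_nonneg hM0 (hη k)) (hδ k)
  -- The bound `M` turns the factor 1 + η_k into an additive error M η_k; removing the accumulated
  -- errors and restoring the accumulated losses gives a decreasing sequence.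
  set t : ℕ → ℝ := fun k => r k + ∑ i ∈ Finset.range k, s i -
    ∑ i ∈ Finset.range k, (M * η i + δ i) with ht
  have hanti : Antitone t := by
    refine antitone_nat_of_succ_le fun k => ?_
    simp only [ht, Finset.sum_range_succ]
    nlinarith [h k, hM k, hη k]
  have hle := fun k => he_sum.sum_le_tsum (Finset.range k) fun i _ => he0 i
  have hs_sum : Summable s := by
    refine summable_of_sum_range_le (c := t 0 + ∑' i, (M * η i + δ i)) hs fun k => ?_
    have := hanti (Nat.zero_le k)
    have h2 := hr k
    have h3 := hle k
    simp only [ht] at this ⊢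
    linarith
  refine ⟨?_, hs_sum⟩
  have hbdd : BddBelow (Set.range t) := by
    refine ⟨- ∑' i, (M * η i + δ i), ?_⟩
    rintro _ ⟨k, rfl⟩
    have h2 := hr k
    have h3 := hle k
    have h4 : 0 ≤ ∑ i ∈ Finset.range k, s i := Finset.sum_nonneg fun i _ => hs i
    simp only [ht]
    linarith
  have h5 := ((tendsto_atTop_ciInf hanti hbdd).sub hs_sum.hasSum.tendsto_sum_nat).add
    he_sum.hasSum.tendsto_sum_nat
  refine ⟨_, h5.congr fun k => ?_⟩
  simp only [ht]
  ring

/-! ### Quasi-Fejér monotonicity of the iteration. -/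

section Iteration

variable [CompleteSpace H]

/-- A relaxed forward-backward iteration with summable errors `e` in a variable metric. -/
structure Iteration (C : Set H) (f : H → ℝ) (α β μ : ℝ) (U : ℕ → H →L[ℝ] H) (γ η lam : ℕ → ℝ)
    (e x : ℕ → H) : Prop extends Setting C f α β μ U γ where
  η_nonneg : ∀ k, 0 ≤ η k
  η_summable : Summable η
  inner_succ_le : ∀ k v, inner ℝ ((U (k + 1)).inverse v) v ≤
    (1 + η k) * inner ℝ ((U k).inverse v) v
  lam_pos : ∀ k, 0 < lam k
  lam_lt : ∀ k, lam k < 1 / avgConst β (γ k) (U k)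
  error_summable : Summable fun k => lam k * ‖e k‖
  x_succ : ∀ k, x (k + 1) = x k + lam k • (step C f (U k) (γ k) (x k) - x k) + lam k • e k

namespace Iteration

variable {C : Set H} {f : H → ℝ} {α β μ : ℝ} {U : ℕ → H →L[ℝ] H} {γ η lam : ℕ → ℝ} {e x : ℕ → H}

theorem wnorm_succ_le (h : Iteration C f α β μ U γ η lam e x) (k : ℕ) (v : H) :
    wnorm (U (k + 1)).inverse v ≤ (1 + η k) * wnorm (U k).inverse v := by
  have h1 := h.η_nonneg k
  refine le_of_sq_le_sq ?_ (mul_nonneg (by linarith) (wnorm_nonneg _ _))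
  rw [mul_pow, wnorm_sq (h.isPositive _), wnorm_sq (h.isPositive _)]
  refine (h.inner_succ_le k v).trans ?_
  have := inner_nonneg_of_isPositive (h.isPositive k) v
  gcongr
  nlinarith

theorem decrease_nonneg (h : Iteration C f α β μ U γ η lam e x) (k : ℕ) :
    0 ≤ lam k * (1 / avgConst β (γ k) (U k) - lam k) :=
  mul_nonneg (h.lam_pos k).le (sub_nonneg.2 (h.lam_lt k).le)

theorem wnorm_relaxed_le (h : Iteration C f α β μ U γ η lam e x) {z : H}
    (hz : z ∈ solutionSet f C) (k : ℕ) :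
    wnorm (U k).inverse (x k + lam k • (step C f (U k) (γ k) (x k) - x k) - z) ≤
      wnorm (U k).inverse (x k - z) := by
  refine le_of_sq_le_sq ?_ (wnorm_nonneg _ _)
  rw [h.inner_relaxed_step k z]
  have h1 := mul_nonneg (h.decrease_nonneg k)
    (sq_nonneg (wnorm (U k).inverse (x k - step C f (U k) (γ k) (x k))))
  have h2 := mul_nonneg (h.lam_pos k).le (h.slack_nonneg_of_mem k hz (x k))
  linarith

theorem wnorm_error_le (h : Iteration C f α β μ U γ η lam e x) (k : ℕ) :
    wnorm (U k).inverse (lam k • e k) ≤ lam k * ‖e k‖ / √α := by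
  have := h.wnorm_le k (lam k • e k)
  rwa [norm_smul, Real.norm_eq_abs, abs_of_pos (h.lam_pos k)] at this

theorem wnorm_succ_sub_le (h : Iteration C f α β μ U γ η lam e x) (k : ℕ) (z : H) :
    wnorm (U k).inverse (x (k + 1) - z) ≤
      wnorm (U k).inverse (x k + lam k • (step C f (U k) (γ k) (x k) - x k) - z) +
        lam k * ‖e k‖ / √α := by
  rw [h.x_succ, add_sub_right_comm]
  exact (wnorm_add_le (h.isPositive k) _ _).trans (by gcongr; exact h.wnorm_error_le k)

theorem scaled_error_nonneg (h : Iteration C f α β μ U γ η lam e x) (k : ℕ) :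
    0 ≤ lam k * ‖e k‖ / √α := (wnorm_nonneg _ _).trans (h.wnorm_error_le k)

theorem η_le (h : Iteration C f α β μ U γ η lam e x) (k : ℕ) : η k ≤ ∑' i, η i :=
  h.η_summable.le_tsum k fun i _ => h.η_nonneg i

/-- The distances to a solution in the variable metric converge. -/
theorem exists_tendsto_wnorm (h : Iteration C f α β μ U γ η lam e x) {z : H}
    (hz : z ∈ solutionSet f C) :
    ∃ l, Tendsto (fun k => wnorm (U k).inverse (x k - z)) atTop (𝓝 l) := by
  refine (exists_tendsto_and_summable (s := fun _ => 0)
    (δ := fun k => (1 + ∑' i, η i) * (lam k * ‖e k‖ / √α))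
    (fun k => wnorm_nonneg _ _) (fun _ => le_rfl) h.η_nonneg (fun k => ?_) h.η_summable
    ((h.error_summable.div_const _).mul_left _) (fun k => ?_)).1
  · have h1 := h.scaled_error_nonneg k
    have h2 := h.η_le k
    have h3 := h.η_nonneg k
    exact mul_nonneg (by linarith) h1
  · have h1 := h.scaled_error_nonneg k
    have h2 := h.η_le k
    have h3 := h.η_nonneg k
    calc _ ≤ (1 + η k) * wnorm (U k).inverse (x (k + 1) - z) := h.wnorm_succ_le k _
      _ ≤ (1 + η k) * (wnorm (U k).inverse (x k - z) + lam k * ‖e k‖ / √α) := by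
        gcongr
        exact (h.wnorm_succ_sub_le k z).trans (by gcongr; exact h.wnorm_relaxed_le hz k)
      _ = (1 + η k) * wnorm (U k).inverse (x k - z) + (1 + η k) * (lam k * ‖e k‖ / √α) := by ring
      _ ≤ (1 + η k) * wnorm (U k).inverse (x k - z) - 0 +
          (1 + ∑' i, η i) * (lam k * ‖e k‖ / √α) := by rw [sub_zero]; gcongr

theorem exists_wnorm_le (h : Iteration C f α β μ U γ η lam e x) {z : H}
    (hz : z ∈ solutionSet f C) : ∃ M, 0 ≤ M ∧ ∀ k, wnorm (U k).inverse (x k - z) ≤ M := by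
  obtain ⟨l, hl⟩ := h.exists_tendsto_wnorm hz
  obtain ⟨M, hM⟩ := hl.bddAbove_range
  exact ⟨M, (wnorm_nonneg _ _).trans (hM ⟨0, rfl⟩), fun k => hM ⟨k, rfl⟩⟩

theorem exists_norm_sub_le (h : Iteration C f α β μ U γ η lam e x) {z : H}
    (hz : z ∈ solutionSet f C) : ∃ M, 0 ≤ M ∧ ∀ k, ‖x k - z‖ ≤ M := by
  obtain ⟨M, hM0, hM⟩ := h.exists_wnorm_le hz
  exact ⟨√μ * M, by positivity, fun k => (h.norm_le_wnorm k _).trans (by gcongr; exact hM k)⟩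

/-- Squared distances are needed to keep both losses. The cross term between distance and error is
summable because the distances are already known to be bounded. -/
theorem summable_decrease (h : Iteration C f α β μ U γ η lam e x) {z : H}
    (hz : z ∈ solutionSet f C) :
    Summable fun k => lam k * (1 / avgConst β (γ k) (U k) - lam k) *
        wnorm (U k).inverse (x k - step C f (U k) (γ k) (x k)) ^ 2 +
      lam k * slack β (γ k) (U k) (x k - step C f (U k) (γ k) (x k))
        (step C f (U k) (γ k) (x k) - z) := by
  obtain ⟨M, hM0, hM⟩ := h.exists_wnorm_le hz
  set ε : ℕ → ℝ := fun k => lam k * ‖e k‖ / √α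
  have hε_sum : Summable ε := h.error_summable.div_const _
  have hε0 : ∀ k, 0 ≤ ε k := h.scaled_error_nonneg
  have hεle : ∀ k, ε k ≤ ∑' i, ε i := fun k => hε_sum.le_tsum k fun i _ => hε0 i
  have hE0 : 0 ≤ ∑' i, ε i := (hε0 0).trans (hεle 0)
  have hη0 : 0 ≤ ∑' i, η i := (h.η_nonneg 0).trans (h.η_le 0)
  refine (exists_tendsto_and_summable (r := fun k => wnorm (U k).inverse (x k - z) ^ 2)
    (δ := fun k => (1 + ∑' i, η i) * ((2 * M + ∑' i, ε i) * ε k))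
    (fun k => sq_nonneg _) (fun k => ?_) h.η_nonneg (fun k => ?_) h.η_summable
    ((hε_sum.mul_left _).mul_left _) (fun k => ?_)).2
  · exact add_nonneg (mul_nonneg (h.decrease_nonneg k) (sq_nonneg _))
      (mul_nonneg (h.lam_pos k).le (h.slack_nonneg_of_mem k hz _))
  · have := hε0 k
    positivity
  · have h1 := h.inner_relaxed_step k z (lam k) (x k)
    have h2 := h.wnorm_relaxed_le hz k
    have h3 := h.wnorm_succ_sub_le k z
    have h0 := mul_nonneg (h.decrease_nonneg k)
      (sq_nonneg (wnorm (U k).inverse (x k - step C f (U k) (γ k) (x k))))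
    have h0' := mul_nonneg (h.lam_pos k).le (h.slack_nonneg_of_mem k hz (x k))
    set s := lam k * (1 / avgConst β (γ k) (U k) - lam k) *
        wnorm (U k).inverse (x k - step C f (U k) (γ k) (x k)) ^ 2
    set s' := lam k * slack β (γ k) (U k) (x k - step C f (U k) (γ k) (x k))
        (step C f (U k) (γ k) (x k) - z)
    set N := wnorm (U k).inverse (x k + lam k • (step C f (U k) (γ k) (x k) - x k) - z)
    have hN0 : 0 ≤ N := wnorm_nonneg _ _
    have h4 : wnorm (U k).inverse (x (k + 1) - z) ^ 2 ≤
        wnorm (U k).inverse (x k - z) ^ 2 - (s + s') + (2 * M + ∑' i, ε i) * ε k := by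
      have h5 : wnorm (U k).inverse (x (k + 1) - z) ^ 2 ≤ (N + ε k) ^ 2 := by
        gcongr
        exact wnorm_nonneg _ _
      have h6 : N * ε k ≤ M * ε k := mul_le_mul_of_nonneg_right (h2.trans (hM k)) (hε0 k)
      have h7 : ε k * ε k ≤ (∑' i, ε i) * ε k := mul_le_mul_of_nonneg_right (hεle k) (hε0 k)
      nlinarith
    have h8 : wnorm (U (k + 1)).inverse (x (k + 1) - z) ^ 2 ≤
        (1 + η k) * wnorm (U k).inverse (x (k + 1) - z) ^ 2 := by
      rw [wnorm_sq (h.isPositive _), wnorm_sq (h.isPositive _)]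
      exact h.inner_succ_le k _
    have h9 := h.η_nonneg k
    have h10 := h.η_le k
    have h11 : 0 ≤ (2 * M + ∑' i, ε i) * ε k := by have := hε0 k; positivity
    calc _ ≤ (1 + η k) * (wnorm (U k).inverse (x k - z) ^ 2 - (s + s') +
          (2 * M + ∑' i, ε i) * ε k) := h8.trans (by gcongr)
      _ = (1 + η k) * wnorm (U k).inverse (x k - z) ^ 2 - (s + s') - η k * (s + s') +
          (1 + η k) * ((2 * M + ∑' i, ε i) * ε k) := by ring
      _ ≤ (1 + η k) * wnorm (U k).inverse (x k - z) ^ 2 - (s + s') - 0 +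
          (1 + ∑' i, η i) * ((2 * M + ∑' i, ε i) * ε k) := by gcongr; positivity
      _ = _ := by rw [sub_zero]

theorem summable_decrease_left (h : Iteration C f α β μ U γ η lam e x) {z : H}
    (hz : z ∈ solutionSet f C) :
    Summable fun k => lam k * (1 / avgConst β (γ k) (U k) - lam k) *
        wnorm (U k).inverse (x k - step C f (U k) (γ k) (x k)) ^ 2 :=
  (h.summable_decrease hz).of_nonneg_of_le
    (fun k => mul_nonneg (h.decrease_nonneg k) (sq_nonneg _))
    fun k => le_add_of_nonneg_right (mul_nonneg (h.lam_pos k).le (h.slack_nonneg_of_mem k hz _))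

theorem summable_slack (h : Iteration C f α β μ U γ η lam e x) {z : H}
    (hz : z ∈ solutionSet f C) :
    Summable fun k => lam k * slack β (γ k) (U k) (x k - step C f (U k) (γ k) (x k))
        (step C f (U k) (γ k) (x k) - z) :=
  (h.summable_decrease hz).of_nonneg_of_le
    (fun k => mul_nonneg (h.lam_pos k).le (h.slack_nonneg_of_mem k hz _))
    fun k => le_add_of_nonneg_left (mul_nonneg (h.decrease_nonneg k) (sq_nonneg _))

/-- If the relaxation parameters stay away from the ends of the admissible interval, then the
residuals tend to zero. -/
theorem tendsto_residual_of_le (h : Iteration C f α β μ U γ η lam e x) {z : H}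
    (hz : z ∈ solutionSet f C) {lam₀ τ : ℝ} (hlam₀ : 0 < lam₀) (hτ : 0 < τ)
    (hlam : ∀ k, lam₀ ≤ lam k ∧ lam k ≤ 1 / avgConst β (γ k) (U k) - τ) :
    Tendsto (fun k => ‖x k - step C f (U k) (γ k) (x k)‖) atTop (𝓝 0) := by
  have h1 : Tendsto (fun k => √μ * √((lam₀ * τ)⁻¹ *
      (lam k * (1 / avgConst β (γ k) (U k) - lam k) *
        wnorm (U k).inverse (x k - step C f (U k) (γ k) (x k)) ^ 2))) atTop (𝓝 0) := by
    have := ((h.summable_decrease_left hz).tendsto_atTop_zero.const_mul ((lam₀ * τ)⁻¹)).sqrt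
    simpa using this.const_mul √μ
  refine squeeze_zero (fun k => norm_nonneg _) (fun k => ?_) h1
  refine (h.norm_le_wnorm k _).trans ?_
  gcongr
  refine Real.le_sqrt_of_sq_le ?_
  rw [← mul_assoc]
  refine le_mul_of_one_le_left (sq_nonneg _) ?_
  rw [inv_mul_eq_div, one_le_div (by positivity)]
  have h2 := (hlam k).1
  have h3 := (hlam k).2
  exact mul_le_mul h2 (by linarith) hτ.le (h.lam_pos k).le

end Iteration

end Iteration

/-! ### Weak convergence and convergence of gradients. -/

section Weak

variable [CompleteSpace H]

/-- A bounded decreasing sequence of positive operators converges strongly. -/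
theorem exists_tendsto_apply_of_antitone {A : ℕ → H →L[ℝ] H} (hA : ∀ n, (A n).IsPositive) {K : ℝ}
    (hK : ∀ n, ‖A n‖ ≤ K) (hanti : ∀ v, Antitone fun n => inner ℝ (A n v) v) (v : H) :
    ∃ l, Tendsto (fun n => A n v) atTop (𝓝 l) := by
  have hK0 : 0 ≤ K := (norm_nonneg _).trans (hK 0)
  -- `norm_apply_sq_le` for the positive operator A_m - A_n turns convergence of the quadratic forms
  -- into the Cauchy property of A_n v.
  have hkey : ∀ m n, m ≤ n →
      ‖A m v - A n v‖ ^ 2 ≤ 2 * K * (inner ℝ (A m v) v - inner ℝ (A n v) v) := by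
    intro m n hmn
    have hD : (A m - A n).IsPositive := by
      refine (ContinuousLinearMap.isPositive_iff _).2 ⟨?_, fun u => ?_⟩
      · exact (hA m).isSymmetric.sub (hA n).isSymmetric
      · change 0 ≤ inner ℝ (A m u - A n u) u
        rw [inner_sub_left]
        exact sub_nonneg.2 (hanti u hmn)
    have h1 := norm_apply_sq_le hD v
    have h2 : ‖A m - A n‖ ≤ 2 * K := (norm_sub_le _ _).trans (by linarith [hK m, hK n])
    change ‖A m v - A n v‖ ^ 2 ≤ ‖A m - A n‖ * inner ℝ (A m v - A n v) v at h1
    rw [inner_sub_left] at h1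
    refine h1.trans ?_
    have := sub_nonneg.2 (hanti v hmn)
    gcongr
  have hbdd : BddBelow (Set.range fun n => inner ℝ (A n v) v) :=
    ⟨0, by rintro _ ⟨n, rfl⟩; exact inner_nonneg_of_isPositive (hA n) v⟩
  have hlim := tendsto_atTop_ciInf (hanti v) hbdd
  set l := ⨅ n, inner ℝ (A n v) v
  refine cauchySeq_tendsto_of_complete (cauchySeq_of_le_tendsto_0
    (fun N => 2 * √(2 * K * (inner ℝ (A N v) v - l))) ?_ ?_)
  · have hb : ∀ N n, N ≤ n → ‖A N v - A n v‖ ≤ √(2 * K * (inner ℝ (A N v) v - l)) := by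
      intro N n h
      refine Real.le_sqrt_of_sq_le ((hkey N n h).trans ?_)
      gcongr
      exact ciInf_le hbdd n
    intro n m N hn hm
    rw [dist_eq_norm]
    have h1 := norm_sub_le (A N v - A m v) (A N v - A n v)
    rw [sub_sub_sub_cancel_left] at h1
    linarith [hb N n hn, hb N m hm]
  · have := ((hlim.sub_const l).const_mul (2 * K)).sqrt.const_mul 2
    simpa using this

/-- Banach-Alaoglu through the Riesz isomorphism. Limits along ultrafilters replace weakly
convergent subsequences. -/
theorem exists_tendsto_inner_of_ultrafilter {x : ℕ → H} {M : ℝ} (hx : ∀ k, ‖x k‖ ≤ M)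
    (F : Ultrafilter ℕ) : ∃ p : H, ∀ v, Tendsto (fun k => inner ℝ (x k) v) F (𝓝 (inner ℝ p v)) := by
  set T : ℕ → WeakDual ℝ H := fun k =>
    StrongDual.toWeakDual (InnerProductSpace.toDual ℝ H (x k)) with hT
  have hmem : ∀ k, T k ∈ WeakDual.toStrongDual ⁻¹' Metric.closedBall (0 : StrongDual ℝ H) M := by
    intro k
    simp [hT, hx k]
  obtain ⟨φ, -, hφ⟩ :=
    (WeakDual.isCompact_closedBall (𝕜 := ℝ) (0 : StrongDual ℝ H) M).ultrafilter_le_nhds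
    (F.map T) (by
      rw [le_principal_iff]
      exact Filter.mem_map.2 (Filter.univ_mem' hmem))
  refine ⟨(InnerProductSpace.toDual ℝ H).symm (WeakDual.toStrongDual φ), fun v => ?_⟩
  have h1 : Tendsto T F (𝓝 φ) := hφ
  have h2 := ((WeakDual.eval_continuous v).tendsto φ).comp h1
  rw [InnerProductSpace.toDual_symm_apply]
  exact h2

theorem weaklyConvergesTo_of_tendsto_inner {x : ℕ → H} {p : H}
    (h : ∀ v, Tendsto (fun k => inner ℝ (x k) v) atTop (𝓝 (inner ℝ p v))) :
    WeaklyConvergesTo x p := by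
  refine (WeakBilin.tendsto_iff_forall_eval_tendsto _ ?_).2 fun φ => ?_
  · intro a b hab
    refine ext_inner_left ℝ fun v => ?_
    have := congrArg (fun g => g (InnerProductSpace.toDual ℝ H v)) hab
    simpa using this
  · have := h ((InnerProductSpace.toDual ℝ H).symm φ)
    have e : ∀ u : H, inner ℝ u ((InnerProductSpace.toDual ℝ H).symm φ) = φ u := by
      intro u
      rw [real_inner_comm, InnerProductSpace.toDual_symm_apply]
    simp only [e] at this
    exact this

namespace Iteration

variable {C : Set H} {f : H → ℝ} {α β μ : ℝ} {U : ℕ → H →L[ℝ] H} {γ η lam : ℕ → ℝ} {e x : ℕ → H}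

/-- The inverse metrics converge strongly. -/
theorem exists_tendsto_inverse_apply (h : Iteration C f α β μ U γ η lam e x) (v : H) :
    ∃ l, Tendsto (fun k => (U k).inverse v) atTop (𝓝 l) := by
  -- Dividing U_n⁻¹ by this product makes the sequence decreasing. The product itself converges
  -- since η is summable.
  set E : ℕ → ℝ := fun n => ∏ i ∈ Finset.range n, (1 + η i) with hE
  have hE1 : ∀ n, 1 ≤ E n := fun n =>
    Finset.one_le_prod fun i _ => by linarith [h.η_nonneg i]
  have hE0 : ∀ n, 0 < E n := fun n => one_pos.trans_le (hE1 n)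
  have hEs : ∀ n, E (n + 1) = E n * (1 + η n) := fun n => Finset.prod_range_succ _ _
  have hEmono : Monotone E := monotone_nat_of_le_succ fun n => by
    rw [hEs]
    exact le_mul_of_one_le_right (hE0 n).le (by linarith [h.η_nonneg n])
  have hEbdd : BddAbove (Set.range E) := by
    refine ⟨Real.exp (∑' i, η i), ?_⟩
    rintro _ ⟨n, rfl⟩
    calc E n ≤ ∏ i ∈ Finset.range n, Real.exp (η i) :=
          Finset.prod_le_prod (fun i _ => by linarith [h.η_nonneg i])
            fun i _ => by linarith [Real.add_one_le_exp (η i)]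
      _ = Real.exp (∑ i ∈ Finset.range n, η i) := (Real.exp_sum _ _).symm
      _ ≤ _ := Real.exp_le_exp.2 (h.η_summable.sum_le_tsum _ fun i _ => h.η_nonneg i)
  have hElim := tendsto_atTop_ciSup hEmono hEbdd
  have hA : ∀ n, ((E n)⁻¹ • (U n).inverse).IsPositive := fun n =>
    (h.isPositive n).smul_of_nonneg (inv_nonneg.2 (hE0 n).le)
  have hnorm : ∀ n, ‖(E n)⁻¹ • (U n).inverse‖ ≤ 1 / α := by
    intro n
    refine ContinuousLinearMap.opNorm_le_bound _ (one_div_nonneg.2 h.α_pos.le) fun u => ?_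
    change ‖(E n)⁻¹ • (U n).inverse u‖ ≤ _
    rw [norm_smul, Real.norm_eq_abs, abs_of_pos (inv_pos.2 (hE0 n))]
    calc _ ≤ 1 * (‖u‖ / α) := by
          gcongr
          · exact inv_le_one_of_one_le₀ (hE1 n)
          · exact (h.isP n).norm_inverse_apply_le h.α_pos u
      _ = _ := by ring
  have hanti : ∀ u, Antitone fun n => inner ℝ (((E n)⁻¹ • (U n).inverse) u) u := by
    intro u
    refine antitone_nat_of_succ_le fun n => ?_
    change inner ℝ ((E (n + 1))⁻¹ • (U (n + 1)).inverse u) u ≤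
      inner ℝ ((E n)⁻¹ • (U n).inverse u) u
    rw [real_inner_smul_left, real_inner_smul_left, inv_mul_le_iff₀ (hE0 _), hEs,
      mul_right_comm, mul_inv_cancel_left₀ (hE0 n).ne']
    exact (h.inner_succ_le n u).trans_eq (mul_comm _ _)
  obtain ⟨l, hl⟩ := exists_tendsto_apply_of_antitone hA hnorm hanti v
  refine ⟨_, (hElim.smul hl).congr fun n => ?_⟩
  change E n • (E n)⁻¹ • (U n).inverse v = _
  rw [smul_smul, mul_inv_cancel₀ (hE0 n).ne', one_smul]

/-- Opial's argument. Subtracting the squared distances to p and q shows that ⟨U_k⁻¹(p - q), x_k⟩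
converges. Replacing U_k⁻¹(p - q) by its strong limit ω shows that ⟨x_k, ω⟩ converges, whence ⟨p, ω⟩
= ⟨q, ω⟩. Then ⟨U_k⁻¹(p - q), p - q⟩ → 0, and ‖p - q‖² is at most μ times this. -/
theorem eq_of_tendsto_inner (h : Iteration C f α β μ U γ η lam e x) {p q : H}
    (hp : p ∈ solutionSet f C) (hq : q ∈ solutionSet f C) {F G : Filter ℕ} [F.NeBot] [G.NeBot]
    (hF : F ≤ atTop) (hG : G ≤ atTop)
    (hpF : ∀ v, Tendsto (fun k => inner ℝ (x k) v) F (𝓝 (inner ℝ p v)))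
    (hqG : ∀ v, Tendsto (fun k => inner ℝ (x k) v) G (𝓝 (inner ℝ q v))) : p = q := by
  obtain ⟨M, hM0, hM⟩ := h.exists_norm_sub_le hp
  obtain ⟨lp, hlp⟩ := h.exists_tendsto_wnorm hp
  obtain ⟨lq, hlq⟩ := h.exists_tendsto_wnorm hq
  obtain ⟨wp, hwp⟩ := h.exists_tendsto_inverse_apply p
  obtain ⟨wq, hwq⟩ := h.exists_tendsto_inverse_apply q
  have hd : Tendsto (fun k => (U k).inverse (p - q)) atTop (𝓝 (wp - wq)) := by
    simpa only [map_sub] using hwp.sub hwq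
  set ω := wp - wq
  have h1 : ∃ c, Tendsto (fun k => inner ℝ ((U k).inverse (p - q)) (x k)) atTop (𝓝 c) := by
    have h2 := ((((hlq.pow 2).sub (hlp.pow 2)).add (hwp.inner (tendsto_const_nhds (x := p)))).sub
      (hwq.inner (tendsto_const_nhds (x := q)))).mul_const (1 / 2 : ℝ)
    refine ⟨_, h2.congr fun k => ?_⟩
    rw [wnorm_sq (h.isPositive k), wnorm_sq (h.isPositive k), inner_apply_sub (h.isPositive k),
      inner_apply_sub (h.isPositive k), map_sub, inner_sub_left,
      inner_apply_comm (h.isPositive k) p (x k), inner_apply_comm (h.isPositive k) q (x k)]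
    ring
  obtain ⟨c, hc⟩ := h1
  have h3 : Tendsto (fun k => inner ℝ ((U k).inverse (p - q) - ω) (x k)) atTop (𝓝 0) := by
    have h4 : Tendsto (fun k => ‖(U k).inverse (p - q) - ω‖ * (M + ‖p‖)) atTop (𝓝 0) := by
      have := (hd.sub_const ω).norm.mul_const (M + ‖p‖)
      simpa using this
    refine squeeze_zero_norm (fun k => (norm_inner_le_norm _ _).trans ?_) h4
    gcongr
    have := norm_add_le (x k - p) p
    rw [sub_add_cancel] at this
    linarith [hM k]
  have h5 : Tendsto (fun k => inner ℝ (x k) ω) atTop (𝓝 c) := by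
    have := hc.sub h3
    rw [sub_zero] at this
    refine this.congr fun k => ?_
    rw [← inner_sub_left, sub_sub_cancel, real_inner_comm]
  have h6 : inner ℝ p ω = c := tendsto_nhds_unique (hpF ω) (h5.mono_left hF)
  have h7 : inner ℝ q ω = c := tendsto_nhds_unique (hqG ω) (h5.mono_left hG)
  have h8 : Tendsto (fun k => μ * inner ℝ ((U k).inverse (p - q)) (p - q)) atTop (𝓝 0) := by
    have := (hd.inner (tendsto_const_nhds (x := p - q))).const_mul μ
    rwa [real_inner_comm, inner_sub_left, h6, h7, sub_self, mul_zero] at this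
  have h9 : ‖p - q‖ ^ 2 ≤ 0 := ge_of_tendsto' h8 fun k => h.norm_sq_le k _
  have h10 : ‖p - q‖ = 0 := by nlinarith [norm_nonneg (p - q)]
  exact sub_eq_zero.1 (norm_eq_zero.1 h10)

theorem exists_norm_le (h : Iteration C f α β μ U γ η lam e x) {z : H}
    (hz : z ∈ solutionSet f C) : ∃ M, 0 ≤ M ∧ (∀ k, ‖x k‖ ≤ M) ∧
      (∀ k, ‖step C f (U k) (γ k) (x k)‖ ≤ M) ∧ (∀ k, ‖gradient f (x k)‖ ≤ M) ∧
      ∀ k, ‖x k - step C f (U k) (γ k) (x k)‖ ≤ M := by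
  obtain ⟨M, hM0, hM⟩ := h.exists_norm_sub_le hz
  have hβ := h.β_pos
  have h1 : ∀ k, ‖x k‖ ≤ M + ‖z‖ := fun k => by
    have := norm_add_le (x k - z) z
    rw [sub_add_cancel] at this
    linarith [hM k]
  have h2 : ∀ k, ‖step C f (U k) (γ k) (x k)‖ ≤ √μ / √α * M + ‖z‖ := fun k => by
    have h3 := h.norm_step_sub_le k (x k) z
    rw [h.step_eq_self k hz] at h3
    have := norm_add_le (step C f (U k) (γ k) (x k) - z) z
    rw [sub_add_cancel] at this
    have h4 : √μ / √α * ‖x k - z‖ ≤ √μ / √α * M := by gcongr; exact hM k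
    linarith
  have h3 : ∀ k, ‖gradient f (x k)‖ ≤ M / β + ‖gradient f z‖ := fun k => by
    have h4 := h.norm_gradient_sub_le (x k) z
    have := norm_add_le (gradient f (x k) - gradient f z) (gradient f z)
    rw [sub_add_cancel] at this
    have h5 : ‖x k - z‖ / β ≤ M / β := by gcongr; exact hM k
    linarith
  have h4 : 0 ≤ √μ / √α * M := by positivity
  have h5 : 0 ≤ M / β := by positivity
  have h6 := norm_nonneg z
  have h7 := norm_nonneg (gradient f z)
  refine ⟨(M + ‖z‖) + (√μ / √α * M + ‖z‖) + (M / β + ‖gradient f z‖), by positivity,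
    fun k => ?_, fun k => ?_, fun k => ?_, fun k => (norm_sub_le _ _).trans ?_⟩
  · linarith [h1 k]
  · linarith [h2 k]
  · linarith [h3 k]
  · linarith [h1 k, h2 k]

/-- The steps lie in `C` and have the same weak limit as x_k, so p lies in `C`. For optimality
against c, the tangents of f at p and at x_k bound f c below, and the projection inequality tested
with c makes the error proportional to the residual. -/
theorem mem_solutionSet_of_tendsto_inner (h : Iteration C f α β μ U γ η lam e x) {z : H}
    (hz : z ∈ solutionSet f C) {γ₀ : ℝ} (hγ₀ : 0 < γ₀) (hγ : ∀ k, γ₀ ≤ γ k)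
    (hres : Tendsto (fun k => ‖x k - step C f (U k) (γ k) (x k)‖) atTop (𝓝 0))
    {F : Filter ℕ} [F.NeBot] (hF : F ≤ atTop) {p : H}
    (hp : ∀ v, Tendsto (fun k => inner ℝ (x k) v) F (𝓝 (inner ℝ p v))) :
    p ∈ solutionSet f C := by
  obtain ⟨M, hM0, hMx, hMs, hMg, hMr⟩ := h.exists_norm_le hz
  have hα := h.α_pos
  have hresF := hres.mono_left hF
  constructor
  · obtain ⟨q, hq, hqC⟩ := exists_inner_sub_nonpos h.nonempty h.isClosed h.convex p
    have h1 : Tendsto (fun k => inner ℝ (x k - step C f (U k) (γ k) (x k)) (p - q)) F (𝓝 0) := by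
      refine squeeze_zero_norm (fun k => norm_inner_le_norm _ _) ?_
      simpa using hresF.mul_const ‖p - q‖
    have h2 := ((hp (p - q)).sub h1).sub_const (inner ℝ q (p - q))
    have h3 : inner ℝ p (p - q) - 0 - inner ℝ q (p - q) ≤ 0 := by
      refine le_of_tendsto' h2 fun k => ?_
      have := hqC _ (h.step_mem k (x k))
      rw [← inner_sub_left, ← inner_sub_left, sub_sub_cancel, real_inner_comm]
      exact this
    rw [sub_zero, ← inner_sub_left, real_inner_self_eq_norm_sq] at h3
    have h4 : ‖p - q‖ = 0 := by nlinarith [norm_nonneg (p - q)]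
    rwa [sub_eq_zero.1 (norm_eq_zero.1 h4)]
  · intro c hc
    have h1 : Tendsto (fun k => f p + (inner ℝ (x k) (gradient f p) - inner ℝ p (gradient f p)) -
        ‖x k - step C f (U k) (γ k) (x k)‖ * ((‖c‖ + M) / (α * γ₀) + M)) F (𝓝 (f p)) := by
      have := (((hp (gradient f p)).sub_const (inner ℝ p (gradient f p))).const_add (f p)).sub
        (hresF.mul_const ((‖c‖ + M) / (α * γ₀) + M))
      simpa using this
    refine le_of_tendsto' h1 fun k => ?_
    set s := step C f (U k) (γ k) (x k)
    have h2 := add_inner_gradient_le h.convexOn h.differentiable (x k) c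
    have h3 := add_inner_gradient_le h.convexOn h.differentiable p (x k)
    rw [real_inner_comm, inner_sub_left] at h3
    have h4 : inner ℝ ((U k).inverse (x k - s)) (c - s) ≤
        γ k * inner ℝ (gradient f (x k)) (c - s) := h.inner_step_le k (x k) hc
    have h5 : - (‖x k - s‖ / α * (‖c‖ + M)) ≤ inner ℝ ((U k).inverse (x k - s)) (c - s) := by
      refine le_trans (neg_le_neg ?_) (abs_le.1 (abs_real_inner_le_norm _ _)).1
      gcongr
      · exact (h.isP k).norm_inverse_apply_le hα _
      · exact (norm_sub_le _ _).trans (by gcongr; exact hMs k)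
    have h6 : - (‖x k - s‖ * ((‖c‖ + M) / (α * γ₀))) ≤ inner ℝ (gradient f (x k)) (c - s) := by
      rcases le_or_gt 0 (inner ℝ (gradient f (x k)) (c - s)) with h0 | h0
      · exact le_trans (neg_nonpos.2 (by positivity)) h0
      have h7 : γ k * inner ℝ (gradient f (x k)) (c - s) ≤
          γ₀ * inner ℝ (gradient f (x k)) (c - s) :=
        mul_le_mul_of_nonpos_right (hγ k) h0.le
      have h8 : γ₀ * (- (‖x k - s‖ * ((‖c‖ + M) / (α * γ₀)))) = - (‖x k - s‖ / α * (‖c‖ + M)) := by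
        field_simp
      refine le_of_mul_le_mul_left (?_ : γ₀ * _ ≤ _) hγ₀
      linarith
    have h9 : inner ℝ (gradient f (x k)) (c - x k) =
        inner ℝ (gradient f (x k)) (c - s) - inner ℝ (gradient f (x k)) (x k - s) := by
      rw [← inner_sub_right]; congr 1; abel
    have h10 : inner ℝ (gradient f (x k)) (x k - s) ≤ M * ‖x k - s‖ := by
      refine (real_inner_le_norm _ _).trans ?_
      gcongr
      exact hMg k
    linarith

/-- Weak convergence to a solution once the residuals tend to zero. -/
theorem exists_weaklyConvergesTo (h : Iteration C f α β μ U γ η lam e x) {z : H}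
    (hz : z ∈ solutionSet f C) {γ₀ : ℝ} (hγ₀ : 0 < γ₀) (hγ : ∀ k, γ₀ ≤ γ k)
    (hres : Tendsto (fun k => ‖x k - step C f (U k) (γ k) (x k)‖) atTop (𝓝 0)) :
    ∃ p ∈ solutionSet f C, WeaklyConvergesTo x p := by
  obtain ⟨M, -, hMx, -⟩ := h.exists_norm_le hz
  obtain ⟨p, hp⟩ := exists_tendsto_inner_of_ultrafilter hMx (Ultrafilter.of atTop)
  have hpΩ := h.mem_solutionSet_of_tendsto_inner hz hγ₀ hγ hres (Ultrafilter.of_le atTop) hp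
  refine ⟨p, hpΩ, weaklyConvergesTo_of_tendsto_inner fun v => ?_⟩
  refine (tendsto_iff_ultrafilter _ _ _).2 fun G hG => ?_
  obtain ⟨q, hq⟩ := exists_tendsto_inner_of_ultrafilter hMx G
  have hqΩ := h.mem_solutionSet_of_tendsto_inner hz hγ₀ hγ hres hG hq
  rw [h.eq_of_tendsto_inner hpΩ hqΩ (Ultrafilter.of_le atTop) hG hp hq]
  exact hq v

/-- Strong convergence of the gradients once the residuals tend to zero. -/
theorem tendsto_gradient (h : Iteration C f α β μ U γ η lam e x) {z : H}
    (hz : z ∈ solutionSet f C) {γ₀ : ℝ} (hγ₀ : 0 < γ₀) (hγ : ∀ k, γ₀ ≤ γ k)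
    (hres : Tendsto (fun k => ‖x k - step C f (U k) (γ k) (x k)‖) atTop (𝓝 0)) :
    Tendsto (fun k => gradient f (x k)) atTop (𝓝 (gradient f z)) := by
  obtain ⟨M, hM0, hMx, hMs, hMg, hMr⟩ := h.exists_norm_le hz
  have hα := h.α_pos
  have hβ := h.β_pos
  rw [tendsto_iff_norm_sub_tendsto_zero]
  -- Cocoercivity gives β‖g‖² ≤ ⟨g, s - z⟩ + ⟨g, x_k - s⟩. The projection inequality bounds γ_k
  -- times the first term, which is where γ₀ enters; both terms are O(residual).
  set K := ((M + ‖z‖) / (α * γ₀) + (M + ‖gradient f z‖)) / β with hK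
  have h1 : Tendsto (fun k => √(K * ‖x k - step C f (U k) (γ k) (x k)‖)) atTop (𝓝 0) := by
    simpa using (hres.const_mul K).sqrt
  refine squeeze_zero (fun k => norm_nonneg _) (fun k => Real.le_sqrt_of_sq_le ?_) h1
  have h2 := h.inner_gradient_sub_step_sub_le k (x k) z
  have h3 := h.cocoercive_add k (x k) z
  rw [h.step_eq_self k hz, sub_self, sub_zero] at h2 h3
  set s := step C f (U k) (γ k) (x k)
  set g := gradient f (x k) - gradient f z
  rw [inner_add_right] at h3
  have h4 : inner ℝ ((U k).inverse (x k - s)) (s - z) ≤ ‖x k - s‖ / α * (M + ‖z‖) := by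
    refine (real_inner_le_norm _ _).trans ?_
    gcongr
    · exact (h.isP k).norm_inverse_apply_le hα _
    · exact (norm_sub_le _ _).trans (by gcongr; exact hMs k)
  have h5 : inner ℝ g (x k - s) ≤ (M + ‖gradient f z‖) * ‖x k - s‖ := by
    refine (real_inner_le_norm _ _).trans ?_
    gcongr
    exact (norm_sub_le _ _).trans (by gcongr; exact hMg k)
  have h6 : inner ℝ g (s - z) ≤ ‖x k - s‖ * ((M + ‖z‖) / (α * γ₀)) := by
    rcases le_or_gt (inner ℝ g (s - z)) 0 with h0 | h0
    · exact h0.trans (by positivity)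
    have h7 : γ₀ * inner ℝ g (s - z) ≤ γ k * inner ℝ g (s - z) :=
      mul_le_mul_of_nonneg_right (hγ k) h0.le
    have h8 : γ₀ * (‖x k - s‖ * ((M + ‖z‖) / (α * γ₀))) = ‖x k - s‖ / α * (M + ‖z‖) := by
      field_simp
    refine le_of_mul_le_mul_left (?_ : γ₀ * _ ≤ _) hγ₀
    linarith
  rw [hK, div_mul_eq_mul_div, le_div_iff₀ hβ]
  linarith

end Iteration

end Weak

/-! ### From strong absolute summability to operator-norm convergence. -/

section UniformConvergence

variable [CompleteSpace H]

/-- Uniform boundedness for the functionals v ↦ ∑ ⟨s_k, D_k v⟩ with ‖s_k‖ ≤ 1. Taking s_k to be the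
normalized D_k v recovers the sum of norms. -/
theorem exists_sum_norm_apply_le {D : ℕ → H →L[ℝ] H} (hD : ∀ v, Summable fun k => ‖D k v‖) :
    ∃ K, 0 ≤ K ∧ ∀ n v, ∑ k ∈ Finset.range n, ‖D k v‖ ≤ K * ‖v‖ := by
  set g : ℕ × {s : ℕ → H // ∀ k, ‖s k‖ ≤ 1} → H →L[ℝ] ℝ := fun i =>
    ∑ k ∈ Finset.range i.1, (innerSL ℝ (i.2.1 k)).comp (D k)
  have hg : ∀ i v, g i v = ∑ k ∈ Finset.range i.1, inner ℝ (i.2.1 k) (D k v) := by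
    intro i v
    simp [g]
  obtain ⟨K, hK⟩ := banach_steinhaus (g := g) fun v => by
    refine ⟨∑' k, ‖D k v‖, fun i => ?_⟩
    rw [hg]
    refine (norm_sum_le _ _).trans ?_
    refine le_trans (Finset.sum_le_sum fun k _ => ?_)
      ((hD v).sum_le_tsum (Finset.range i.1) fun k _ => norm_nonneg _)
    refine (norm_inner_le_norm _ _).trans ?_
    exact mul_le_of_le_one_left (norm_nonneg _) (i.2.2 k)
  refine ⟨max K 0, le_max_right _ _, fun n v => ?_⟩
  have h1 : ∀ k, ‖(‖D k v‖)⁻¹ • D k v‖ ≤ 1 := fun k => by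
    rw [norm_smul, norm_inv, norm_norm]
    exact inv_mul_le_one
  have h2 : g ⟨n, fun k => (‖D k v‖)⁻¹ • D k v, h1⟩ v = ∑ k ∈ Finset.range n, ‖D k v‖ := by
    rw [hg]
    refine Finset.sum_congr rfl fun k _ => ?_
    change inner ℝ ((‖D k v‖)⁻¹ • D k v) (D k v) = _
    rw [real_inner_smul_left, real_inner_self_eq_norm_sq]
    rcases eq_or_ne ‖D k v‖ 0 with h0 | h0
    · simp [h0]
    · field_simp
  rw [← h2]
  refine (Real.le_norm_self _).trans ((ContinuousLinearMap.le_opNorm _ v).trans ?_)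
  gcongr
  exact (hK _).trans (le_max_left _ _)

theorem two_mul_norm_le_norm_add_add_norm_sub {E : Type*} [SeminormedAddCommGroup E]
    [NormedSpace ℝ E] (a b : E) : 2 * ‖a‖ ≤ ‖a + b‖ + ‖a - b‖ := by
  have h := norm_add_le (a + b) (a - b)
  rwa [add_add_sub_cancel, ← two_smul ℝ, norm_smul, Real.norm_ofNat] at h

/-- If `∑ ‖D k v‖` converges for every `v` in a Hilbert space, then it converges uniformly on the
unit ball. -/
theorem exists_sum_Ico_norm_apply_le {D : ℕ → H →L[ℝ] H} (hD : ∀ v, Summable fun k => ‖D k v‖)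
    {ε : ℝ} (hε : 0 < ε) : ∃ N, ∀ m n v, N ≤ m → ‖v‖ ≤ 1 →
      ∑ k ∈ Finset.Ico m n, ‖D k v‖ ≤ ε := by
  by_contra! hcon
  obtain ⟨K, hK0, hK⟩ := exists_sum_norm_apply_le hD
  -- If uniformity fails, ∑‖D_k v‖ - (ε/2)‖v‖² can be raised by ε/2 indefinitely. Take v' in the
  -- unit ball whose sum over a later block exceeds ε. Averaged over v ± v', the initial sum does
  -- not drop and the block adds more than ε, while by the parallelogram law the penalty grows by at
  -- most ε/2. So one of the two signs works.
  have hind : ∀ j : ℕ, ∃ N v, j * (ε / 2) ≤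
      ∑ k ∈ Finset.range N, ‖D k v‖ - ε / 2 * ‖v‖ ^ 2 := by
    intro j
    induction j with
    | zero => exact ⟨0, 0, by simp⟩
    | succ j ih =>
      obtain ⟨N, v, hv⟩ := ih
      obtain ⟨m, n, v', hNm, hv', hlt⟩ := hcon N
      have hmn : m ≤ n := by
        by_contra! h
        rw [Finset.Ico_eq_empty_of_le h.le, Finset.sum_empty] at hlt
        exact lt_asymm hlt hε
      have hsub : ∀ u, ∑ k ∈ Finset.range N, ‖D k u‖ + ∑ k ∈ Finset.Ico m n, ‖D k u‖ ≤
          ∑ k ∈ Finset.range n, ‖D k u‖ := by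
        intro u
        rw [← Finset.sum_union]
        · refine Finset.sum_le_sum_of_subset_of_nonneg (fun k hk => ?_) fun k _ _ => norm_nonneg _
          simp only [Finset.mem_union, Finset.mem_range, Finset.mem_Ico] at hk ⊢
          omega
        · rw [Finset.disjoint_left]
          intro k hk hk'
          simp only [Finset.mem_range, Finset.mem_Ico] at hk hk'
          omega
      have h1 : 2 * ∑ k ∈ Finset.range N, ‖D k v‖ ≤ ∑ k ∈ Finset.range N, ‖D k (v + v')‖ +
          ∑ k ∈ Finset.range N, ‖D k (v - v')‖ := by
        rw [Finset.mul_sum, ← Finset.sum_add_distrib]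
        refine Finset.sum_le_sum fun k _ => ?_
        rw [map_add, map_sub]
        exact two_mul_norm_le_norm_add_add_norm_sub _ _
      have h2 : 2 * ∑ k ∈ Finset.Ico m n, ‖D k v'‖ ≤ ∑ k ∈ Finset.Ico m n, ‖D k (v + v')‖ +
          ∑ k ∈ Finset.Ico m n, ‖D k (v - v')‖ := by
        rw [Finset.mul_sum, ← Finset.sum_add_distrib]
        refine Finset.sum_le_sum fun k _ => ?_
        rw [map_add, map_sub, add_comm (D k v), norm_sub_rev (D k v)]
        exact two_mul_norm_le_norm_add_add_norm_sub _ _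
      have h3 := parallelogram_law_with_norm ℝ v v'
      have h4 := hsub (v + v')
      have h5 := hsub (v - v')
      have h6 : ‖v'‖ * ‖v'‖ ≤ 1 := mul_le_one₀ hv' (norm_nonneg _) hv'
      have h7 : ε / 2 * (‖v + v'‖ ^ 2 + ‖v - v'‖ ^ 2) ≤ ε / 2 * (2 * (‖v‖ ^ 2 + 1)) := by
        gcongr
        linarith
      push_cast
      by_cases h8 : (j + 1) * (ε / 2) ≤
          ∑ k ∈ Finset.range n, ‖D k (v + v')‖ - ε / 2 * ‖v + v'‖ ^ 2
      · exact ⟨n, v + v', h8⟩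
      · exact ⟨n, v - v', by linarith⟩
  -- The quantity is at most K‖v‖ - (ε/2)‖v‖² ≤ K²/(2ε), so j(ε/2) cannot exceed this.
  obtain ⟨j, hj⟩ := exists_nat_gt (K ^ 2 / ε ^ 2)
  obtain ⟨N, v, hv⟩ := hind j
  have h1 := hK N v
  rw [div_lt_iff₀ (by positivity)] at hj
  have h2 : j * (ε / 2) ≤ K * ‖v‖ - ε / 2 * ‖v‖ ^ 2 := by linarith
  have h3 : j * (ε / 2) * (2 * ε) ≤ (K * ‖v‖ - ε / 2 * ‖v‖ ^ 2) * (2 * ε) := by gcongr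
  nlinarith [sq_nonneg (K - ε * ‖v‖)]

/-- A sequence of operators on a Hilbert space whose increments are strongly absolutely summable is
a Cauchy sequence in the operator norm. -/
theorem cauchySeq_of_summable_norm_apply_sub {W : ℕ → H →L[ℝ] H}
    (hW : ∀ v, Summable fun k => ‖W k v - W (k + 1) v‖) : CauchySeq W := by
  have hD : ∀ v, Summable fun k => ‖(W k - W (k + 1)) v‖ := hW
  refine Metric.cauchySeq_iff'.2 fun ε hε => ?_
  obtain ⟨N, hN⟩ := exists_sum_Ico_norm_apply_le hD (half_pos hε)
  refine ⟨N, fun n hn => ?_⟩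
  rw [dist_comm, dist_eq_norm]
  refine lt_of_le_of_lt (ContinuousLinearMap.opNorm_le_of_unit_norm (half_pos hε).le
    fun v hv => ?_) (half_lt_self hε)
  refine le_trans ?_ (hN N n v le_rfl hv.le)
  have := dist_le_Ico_sum_dist (fun k => W k v) hn
  simp only [dist_eq_norm] at this
  exact this

end UniformConvergence

/-! ### Vanishing residuals under summable variation. -/

/-- A criterion for a nonnegative sequence with inferior limit zero to converge to zero: its
increase over an interval is controlled by the sum of the increments `d`, which are small where `r`
is small and summable where `r` is large. -/
theorem tendsto_zero_of_controlled_increase {r d : ℕ → ℝ} (hr : ∀ k, 0 ≤ r k) (hd : ∀ k, 0 ≤ d k)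
    {A K : ℝ} (hA : 0 ≤ A) (hK : 0 ≤ K) (hfreq : ∀ ρ > 0, ∀ N, ∃ k ≥ N, r k < ρ)
    (hinc : ∀ ε > 0, ∃ N, ∀ m n, N ≤ m → m ≤ n → r n ≤ r m + ε + K * ∑ k ∈ Finset.Ico m n, d k)
    (hsmall : ∀ ρ > 0, ∃ N, ∀ k ≥ N, r k < ρ → d k ≤ A * ρ)
    (hlarge : ∀ ρ > 0, Summable fun k => if ρ ≤ r k then d k else 0) :
    Tendsto r atTop (𝓝 0) := by
  refine Metric.tendsto_atTop.2 fun ε hε => ?_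
  -- The final bound is below 2ρ + K(A + 1)ρ; the 3 leaves a margin.
  set ρ := ε / (3 + K * (A + 1)) with hρdef
  have hρ : 0 < ρ := by positivity
  set I : ℕ → ℝ := fun k => if ρ ≤ r k then d k else 0 with hI
  have hI0 : ∀ k, 0 ≤ I k := fun k => by
    simp only [hI]
    split_ifs
    exacts [hd k, le_rfl]
  obtain ⟨N₁, hN₁⟩ := hinc ρ hρ
  obtain ⟨N₂, hN₂⟩ := hsmall ρ hρ
  obtain ⟨N₃, hN₃⟩ : ∃ N, ∀ m n, N ≤ m → m ≤ n → ∑ k ∈ Finset.Ico m n, I k ≤ ρ := by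
    obtain ⟨N, hN⟩ := Metric.cauchySeq_iff.1 (hlarge ρ hρ).hasSum.tendsto_sum_nat.cauchySeq ρ hρ
    refine ⟨N, fun m n hm hmn => ?_⟩
    have := hN n (hm.trans hmn) m hm
    rw [Real.dist_eq, ← Finset.sum_Ico_eq_sub _ hmn] at this
    exact ((le_abs_self _).trans_lt this).le
  obtain ⟨m₀, hm₀, hrm₀⟩ := hfreq ρ hρ (max N₁ (max N₂ N₃))
  simp only [ge_iff_le, max_le_iff] at hm₀
  refine ⟨m₀, fun n hn => ?_⟩
  -- Take the last index m ≤ n with r m < ρ. Beyond it only increments in the summable regime occur,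
  -- and the increment at m itself is bounded by `hsmall`.
  have hlast : ∃ m, m₀ ≤ m ∧ m ≤ n ∧ r m < ρ ∧ ∀ k, m < k → k ≤ n → ρ ≤ r k := by
    induction n, hn using Nat.le_induction with
    | base => exact ⟨m₀, le_rfl, le_rfl, hrm₀, fun k h1 h2 => absurd h2 (not_le.2 h1)⟩
    | succ n hn ih =>
      obtain ⟨m, h1, h2, h3, h4⟩ := ih
      rcases lt_or_ge (r (n + 1)) ρ with h5 | h5
      · exact ⟨n + 1, by omega, le_rfl, h5, fun k h6 h7 => absurd h7 (not_le.2 h6)⟩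
      · refine ⟨m, h1, by omega, h3, fun k h6 h7 => ?_⟩
        rcases Nat.le_succ_iff.1 h7 with h8 | h8
        · exact h4 k h6 h8
        · rwa [h8]
  obtain ⟨m, hm, hmn, hrm, hbig⟩ := hlast
  have h1 := hN₁ m n (hm₀.1.trans hm) hmn
  have h2 : ∑ k ∈ Finset.Ico m n, d k ≤ A * ρ + ρ := by
    calc ∑ k ∈ Finset.Ico m n, d k ≤
          ∑ k ∈ Finset.Ico m n, ((if m = k then A * ρ else 0) + I k) := by
          refine Finset.sum_le_sum fun k hk => ?_
          rw [Finset.mem_Ico] at hk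
          rcases eq_or_lt_of_le hk.1 with h3 | h3
          · rw [if_pos h3, ← h3]
            have := hN₂ m (hm₀.2.1.trans hm) hrm
            linarith [hI0 m]
          · rw [if_neg h3.ne, zero_add]
            simp only [hI]
            rw [if_pos (hbig k h3 hk.2.le)]
      _ = (∑ k ∈ Finset.Ico m n, if m = k then A * ρ else 0) + ∑ k ∈ Finset.Ico m n, I k :=
          Finset.sum_add_distrib
      _ ≤ A * ρ + ρ := by
          refine add_le_add ?_ (hN₃ m n (hm₀.2.2.trans hm) hmn)
          rw [Finset.sum_ite_eq]
          split_ifs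
          exacts [le_rfl, by positivity]
  have h3 : K * ∑ k ∈ Finset.Ico m n, d k ≤ K * (A * ρ + ρ) := by gcongr
  have h4 : (3 + K * (A + 1)) * ρ = ε := by
    rw [hρdef]
    field_simp
  rw [Real.dist_eq, sub_zero, abs_of_nonneg (hr n)]
  nlinarith

namespace Iteration

variable [CompleteSpace H] {C : Set H} {f : H → ℝ} {α β μ : ℝ} {U : ℕ → H →L[ℝ] H}
  {γ η lam : ℕ → ℝ} {e x : ℕ → H}

theorem lam_le_two (h : Iteration C f α β μ U γ η lam e x) (k : ℕ) : lam k ≤ 2 := by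
  have h1 := (h.lam_lt k).le
  rw [h.one_div_avgConst] at h1
  have h2 := h.β_pos
  have h3 := (h.γ_pos k).le
  have h4 : 0 ≤ γ k * ‖U k‖ / (2 * β) := by positivity
  linarith

theorem norm_succ_sub_le (h : Iteration C f α β μ U γ η lam e x) (k : ℕ) :
    ‖x (k + 1) - x k‖ ≤ lam k * ‖x k - step C f (U k) (γ k) (x k)‖ + lam k * ‖e k‖ := by
  rw [h.x_succ, add_assoc, add_sub_cancel_left]
  refine (norm_add_le _ _).trans (le_of_eq ?_)
  rw [norm_smul, norm_smul, Real.norm_eq_abs, abs_of_pos (h.lam_pos k),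
    norm_sub_rev (step C f (U k) (γ k) (x k))]

/-- If the residuals stayed above ρ, then μ/ρ² times the summable decrease would dominate λ_k(1/α_k
- λ_k), contradicting divergence. -/
theorem exists_residual_lt (h : Iteration C f α β μ U γ η lam e x) {z : H}
    (hz : z ∈ solutionSet f C)
    (hdiv : Tendsto (fun n => ∑ k ∈ Finset.range n,
      lam k * (1 / avgConst β (γ k) (U k) - lam k)) atTop atTop) {ρ : ℝ} (hρ : 0 < ρ) (N : ℕ) :
    ∃ k ≥ N, ‖x k - step C f (U k) (γ k) (x k)‖ < ρ := by
  by_contra! hcon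
  have h1 : Summable fun k =>
      lam (k + N) * (1 / avgConst β (γ (k + N)) (U (k + N)) - lam (k + N)) := by
    have h0 := (summable_nat_add_iff N).2 (h.summable_decrease_left hz)
    refine (h0.mul_left (μ / ρ ^ 2)).of_nonneg_of_le
      (fun k => h.decrease_nonneg _) fun k => ?_
    have h2 := h.decrease_nonneg (k + N)
    have h3 := h.norm_sq_le (k + N) (x (k + N) - step C f (U (k + N)) (γ (k + N)) (x (k + N)))
    rw [← wnorm_sq (h.isPositive _)] at h3
    have h4 : ρ ^ 2 ≤ ‖x (k + N) - step C f (U (k + N)) (γ (k + N)) (x (k + N))‖ ^ 2 := by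
      gcongr
      exact hcon _ (by omega)
    rw [div_mul_eq_mul_div, le_div_iff₀ (by positivity), mul_left_comm]
    exact mul_le_mul_of_nonneg_left (h4.trans h3) h2
  have h2 := (summable_nat_add_iff (f := fun k =>
    lam k * (1 / avgConst β (γ k) (U k) - lam k)) N).1 h1
  exact not_tendsto_nhds_of_tendsto_atTop hdiv _ h2.hasSum.tendsto_sum_nat

theorem exists_le_slack (h : Iteration C f α β μ U γ η lam e x) {z : H}
    (hz : z ∈ solutionSet f C) {γ₀ ε : ℝ} (hγ₀ : 0 < γ₀) (hε : 0 < ε)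
    (hγ : ∀ k, γ₀ ≤ γ k ∧ γ k * μ ≤ 2 * β - ε) {ρ : ℝ} (hρ : 0 < ρ) :
    ∃ δ > 0, ∀ k, ρ ≤ ‖x k - step C f (U k) (γ k) (x k)‖ →
      δ ≤ slack β (γ k) (U k) (x k - step C f (U k) (γ k) (x k))
        (step C f (U k) (γ k) (x k) - z) := by
  obtain ⟨M, hM0, -, hMs, -⟩ := h.exists_norm_le hz
  have hβ := h.β_pos
  obtain ⟨K, hK⟩ : ∃ K, ∀ k, slack β (γ k) (U k) (x k - step C f (U k) (γ k) (x k))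
      (step C f (U k) (γ k) (x k) - z) ≤ 1 → ‖x k - step C f (U k) (γ k) (x k)‖ ^ 2 ≤
      K * √(slack β (γ k) (U k) (x k - step C f (U k) (γ k) (x k))
        (step C f (U k) (γ k) (x k) - z)) := by
    refine ⟨slackConst α β γ₀ μ (M + ‖z‖) (ε / (2 * β)), fun k hk => ?_⟩
    have h2 := h.inner_gradient_sub_step_sub_le k (x k) z
    have h3 := h.cocoercive_add k (x k) z
    rw [h.step_eq_self k hz, sub_self, sub_zero] at h2 h3
    refine norm_sq_le_of_slack h.α_pos (h.isP k) hβ h2 h3 (M := M + ‖z‖) (θ := ε / (2 * β)) hγ₀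
      (hγ k).1 (h.norm_le k) ((norm_sub_le _ _).trans ?_) (by positivity) ?_ hk
    · gcongr
      exact hMs k
    · have h4 : γ k * ‖U k‖ ≤ γ k * μ :=
        mul_le_mul_of_nonneg_left (h.norm_le k) (h.γ_pos k).le
      have h5 : (1 - ε / (2 * β)) * (2 * β) = 2 * β - ε := by field_simp
      linarith [(hγ k).2]
  -- This solves ρ² ≤ (|K| + 1)√S for S; the value 1 covers S > 1, where the residual bound is not
  -- available.
  refine ⟨min 1 ((ρ ^ 2 / (|K| + 1)) ^ 2), by positivity, fun k hk => ?_⟩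
  have hS0 := h.slack_nonneg_of_mem k hz (x k)
  set S := slack β (γ k) (U k) (x k - step C f (U k) (γ k) (x k))
    (step C f (U k) (γ k) (x k) - z)
  rcases le_or_gt S 1 with hS | hS
  · refine (min_le_right _ _).trans ?_
    have h1 : ρ ^ 2 ≤ (|K| + 1) * √S := by
      calc ρ ^ 2 ≤ ‖x k - step C f (U k) (γ k) (x k)‖ ^ 2 := by gcongr
        _ ≤ K * √S := hK k hS
        _ ≤ (|K| + 1) * √S := by
          gcongr
          linarith [le_abs_self K]
    have h2 : ρ ^ 2 / (|K| + 1) ≤ √S := by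
      rw [div_le_iff₀ (by positivity)]
      linarith
    calc (ρ ^ 2 / (|K| + 1)) ^ 2 ≤ √S ^ 2 := by gcongr
      _ = S := Real.sq_sqrt hS0
  · exact (min_le_left _ _).trans hS.le

/-- If the relaxation parameters are merely not summable towards the ends of the admissible
interval, then the residuals tend to zero, provided that the metrics and the step sizes have
summable variation. -/
theorem tendsto_residual_of_summable (h : Iteration C f α β μ U γ η lam e x) {z : H}
    (hz : z ∈ solutionSet f C)
    (hdiv : Tendsto (fun n => ∑ k ∈ Finset.range n,
      lam k * (1 / avgConst β (γ k) (U k) - lam k)) atTop atTop)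
    {γ₀ ε : ℝ} (hγ₀ : 0 < γ₀) (hε : 0 < ε) (hγ : ∀ k, γ₀ ≤ γ k ∧ γ k * μ ≤ 2 * β - ε)
    (hγ_sum : Summable fun k => |γ (k + 1) - γ k|)
    (hU_sum : ∀ v : H, Summable fun k => ‖(U k).inverse v - (U (k + 1)).inverse v‖) :
    Tendsto (fun k => ‖x k - step C f (U k) (γ k) (x k)‖) atTop (𝓝 0) := by
  obtain ⟨M, hM0, hMx, hMs, hMg, hMr⟩ := h.exists_norm_le hz
  have hμ := h.μ_nonneg
  have hWc : CauchySeq fun k => (U k).inverse := cauchySeq_of_summable_norm_apply_sub hU_sum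
  have hγc : CauchySeq γ := by
    refine cauchySeq_of_summable_dist (hγ_sum.congr fun k => ?_)
    rw [Real.dist_eq, abs_sub_comm]
  -- A = 3 since λ_k ≤ 2 and the error is eventually below ρ. K is a Lipschitz constant of x ↦ x -
  -- T_n x, uniform in n.
  refine tendsto_zero_of_controlled_increase (d := fun k => ‖x (k + 1) - x k‖) (A := 3)
    (K := 1 + √μ / √α) (fun k => norm_nonneg _) (fun k => norm_nonneg _) (by norm_num)
    (by positivity) (fun ρ hρ N => h.exists_residual_lt hz hdiv hρ N) (fun ε' hε' => ?_)
    (fun ρ hρ => ?_) (fun ρ hρ => ?_)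
  · have hc : 0 < ε' / (2 * (μ * M + 1)) := by positivity
    obtain ⟨N₁, hN₁⟩ := Metric.cauchySeq_iff.1 hWc _ hc
    obtain ⟨N₂, hN₂⟩ := Metric.cauchySeq_iff.1 hγc _ hc
    refine ⟨max N₁ N₂, fun m n hm hmn => ?_⟩
    rw [max_le_iff] at hm
    have h1 := hN₁ n (hm.1.trans hmn) m hm.1
    have h2 := hN₂ n (hm.2.trans hmn) m hm.2
    rw [dist_eq_norm] at h1
    rw [Real.dist_eq] at h2
    have h3 := h.norm_step_sub_step_le m n (x m)
    have h4 := h.norm_step_sub_le n (x m) (x n)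
    have h5 : ‖x m - x n‖ ≤ ∑ k ∈ Finset.Ico m n, ‖x (k + 1) - x k‖ := by
      have := dist_le_Ico_sum_dist x hmn
      simpa only [dist_eq_norm, norm_sub_rev] using this
    have h6 : ‖step C f (U n) (γ n) (x m) - step C f (U m) (γ m) (x m)‖ ≤ ε' := by
      refine h3.trans ?_
      calc μ * (|γ n - γ m| * ‖gradient f (x m)‖ + ‖(U n).inverse - (U m).inverse‖ *
            ‖x m - step C f (U m) (γ m) (x m)‖) ≤
            μ * (ε' / (2 * (μ * M + 1)) * M + ε' / (2 * (μ * M + 1)) * M) := by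
            gcongr
            exacts [hMg m, hMr m]
        _ = ε' * (μ * M / (μ * M + 1)) := by field_simp; ring
        _ ≤ ε' * 1 := by
            gcongr
            rw [div_le_one (by positivity)]
            linarith
        _ = ε' := mul_one _
    have h7 : x n - step C f (U n) (γ n) (x n) =
        (x m - step C f (U m) (γ m) (x m)) -
        (step C f (U n) (γ n) (x m) - step C f (U m) (γ m) (x m)) -
        (x m - x n) + (step C f (U n) (γ n) (x m) - step C f (U n) (γ n) (x n)) := by abel
    rw [h7]
    have h8 : (1 + √μ / √α) * ‖x m - x n‖ ≤
        (1 + √μ / √α) * ∑ k ∈ Finset.Ico m n, ‖x (k + 1) - x k‖ := by gcongr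
    refine (norm_add_le _ _).trans ?_
    refine (add_le_add ((norm_sub_le _ _).trans (add_le_add_left (norm_sub_le _ _) _))
      le_rfl).trans ?_
    linarith
  · obtain ⟨N, hN⟩ := Metric.tendsto_atTop.1 h.error_summable.tendsto_atTop_zero ρ hρ
    refine ⟨N, fun k hk hr => ?_⟩
    have h1 := hN k hk
    rw [Real.dist_eq, sub_zero] at h1
    have h2 := h.norm_succ_sub_le k
    have h3 : lam k * ‖x k - step C f (U k) (γ k) (x k)‖ ≤ 2 * ρ :=
      mul_le_mul (h.lam_le_two k) hr.le (norm_nonneg _) (by norm_num)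
    linarith [le_abs_self (lam k * ‖e k‖)]
  -- Where the residual is at least ρ, λ_k‖residual‖ ≤ (M/δ)·λ_k·slack, which is summable.
  · obtain ⟨δ, hδ, hδS⟩ := h.exists_le_slack hz hγ₀ hε hγ hρ
    refine (((h.summable_slack hz).mul_left (M / δ)).add h.error_summable).of_nonneg_of_le
      (fun k => ?_) fun k => ?_
    · split_ifs
      exacts [norm_nonneg _, le_rfl]
    · have h0 : 0 ≤ lam k * ‖e k‖ := mul_nonneg (h.lam_pos k).le (norm_nonneg _)
      have hS0 := h.slack_nonneg_of_mem k hz (x k)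
      have hl := (h.lam_pos k).le
      split_ifs with hk
      · refine (h.norm_succ_sub_le k).trans ?_
        refine add_le_add ?_ le_rfl
        have h1 := hδS k hk
        set S := slack β (γ k) (U k) (x k - step C f (U k) (γ k) (x k))
          (step C f (U k) (γ k) (x k) - z)
        calc lam k * ‖x k - step C f (U k) (γ k) (x k)‖ ≤ lam k * M := by gcongr; exact hMr k
          _ = M / δ * (lam k * δ) := by field_simp
          _ ≤ M / δ * (lam k * S) := by gcongr
      · positivity

end Iteration

end VarMetric

end

/-! ### The main theorem. -/

theorem theorem4p2 {H : Type*} [NormedAddCommGroup H] [InnerProductSpace ℝ H] [CompleteSpace H]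
    -- the problem: minimize `f` over `C`
    (C : Set H) (hC_closed : IsClosed C) (hC_convex : Convex ℝ C)
    (f : H → ℝ) (hf_convex : ConvexOn ℝ Set.univ f) (hf_diff : Differentiable ℝ f)
    (L : ℝ) (hL : 0 < L) (hf_lip : ∀ u v : H, ‖gradient f u - gradient f v‖ ≤ L * ‖u - v‖)
    (hΩ : (VarMetric.solutionSet f C).Nonempty)
    (β : ℝ) (hβ : β = 1 / L)
    -- the variable metric
    (α : ℝ) (hα : 0 < α) (η : ℕ → ℝ) (hη_nonneg : ∀ k, 0 ≤ η k) (hη_sum : Summable η)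
    (U : ℕ → H →L[ℝ] H) (hU : ∀ k, VarMetric.IsP α (U k))
    (hU_bdd : BddAbove (Set.range fun k => ‖U k‖))
    (hU_mono : ∀ k, ∀ v : H, inner ℝ (U k v) v ≤ (1 + η k) * inner ℝ (U (k + 1) v) v)
    (μ : ℝ) (hμ : μ = ⨆ k, ‖U k‖)
    -- step sizes, relaxation parameters, errors
    (γ : ℕ → ℝ) (hγ_pos : ∀ k, 0 < γ k) (hγ_lt : ∀ k, γ k * ‖U k‖ < 2 * β)
    (lam : ℕ → ℝ) (hlam_pos : ∀ k, 0 < lam k)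
    (hlam_lt : ∀ k, lam k < 1 / VarMetric.avgConst β (γ k) (U k))
    (a b : ℕ → H) (ha : Summable fun k => lam k * ‖a k‖) (hb : Summable fun k => lam k * ‖b k‖)
    -- the iteration
    (x y : ℕ → H)
    (hy : ∀ k, y k = x k - γ k • U k (gradient f (x k) + b k))
    (hx : ∀ k, x (k + 1) =
      x k + lam k • (VarMetric.wproj C (U k).inverse (y k) + a k - x k)) :
    -- (i)
    (∀ xs ∈ VarMetric.solutionSet f C, ∃ l : ℝ,
      Tendsto (fun k => VarMetric.wnorm (U k).inverse (x k - xs)) atTop (𝓝 l)) ∧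
    -- first set of parameter conditions
    (∀ lam₀ τ : ℝ, 0 < lam₀ → 0 < τ →
      (∀ k, lam₀ ≤ lam k ∧ lam k ≤ 1 / VarMetric.avgConst β (γ k) (U k) - τ) →
      -- (ii)
      Tendsto (fun k => ‖x k - VarMetric.wproj C (U k).inverse
        (x k - γ k • U k (gradient f (x k)))‖) atTop (𝓝 0) ∧
      ∀ γ₀ : ℝ, 0 < γ₀ → (∀ k, γ₀ ≤ γ k) →
        -- (iii)
        (∃ xs ∈ VarMetric.solutionSet f C, VarMetric.WeaklyConvergesTo x xs) ∧
        -- (iv)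
        ∀ ε : ℝ, 0 < ε → (∀ k, γ k * μ ≤ 2 * β - ε) →
          ∀ xs ∈ VarMetric.solutionSet f C,
            Tendsto (fun k => gradient f (x k)) atTop (𝓝 (gradient f xs))) ∧
    -- second set of parameter conditions
    (Tendsto (fun n => ∑ k ∈ Finset.range n,
        lam k * (1 / VarMetric.avgConst β (γ k) (U k) - lam k)) atTop atTop →
      ∀ γ₀ ε : ℝ, 0 < γ₀ → 0 < ε → (∀ k, γ₀ ≤ γ k ∧ γ k * μ ≤ 2 * β - ε) →
      (Summable fun k => |γ (k + 1) - γ k|) →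
      (Summable fun k => |γ (k + 1) * ‖U (k + 1)‖ - γ k * ‖U k‖|) →
      (∀ v : H, Summable fun k => ‖(U k).inverse v - (U (k + 1)).inverse v‖) →
      -- (ii)
      Tendsto (fun k => ‖x k - VarMetric.wproj C (U k).inverse
        (x k - γ k • U k (gradient f (x k)))‖) atTop (𝓝 0) ∧
      -- (iii)
      (∃ xs ∈ VarMetric.solutionSet f C, VarMetric.WeaklyConvergesTo x xs) ∧
      -- (iv)
      ∀ lam₀ : ℝ, 0 < lam₀ → (∀ k, lam₀ ≤ lam k) →
        ∀ xs ∈ VarMetric.solutionSet f C,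
          Tendsto (fun k => gradient f (x k)) atTop (𝓝 (gradient f xs))) := by 
  obtain ⟨z, hz⟩ := hΩ
  have hβ0 : 0 < β := hβ ▸ one_div_pos.2 hL
  have hS : VarMetric.Setting C f α β μ U γ :=
    { isClosed := hC_closed
      convex := hC_convex
      nonempty := ⟨z, hz.1⟩
      convexOn := hf_convex
      differentiable := hf_diff
      β_pos := hβ0
      cocoercive := hβ ▸ VarMetric.gradient_cocoercive hf_convex hf_diff hL hf_lip
      α_pos := hα
      isP := hU
      norm_le := fun k => hμ ▸ le_ciSup hU_bdd k
      γ_pos := hγ_pos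
      γ_lt := hγ_lt }
  -- The error e_k combines a_k with the displacement of the projection caused by b_k, which is
  -- controlled by nonexpansiveness in the metric U_k⁻¹ and γ_k‖U_k‖ < 2β.
  set e : ℕ → H := fun k => VarMetric.wproj C (U k).inverse (y k) + a k -
    VarMetric.step C f (U k) (γ k) (x k) with he
  have he_le : ∀ k, ‖e k‖ ≤ ‖a k‖ + √μ * (2 * β / √α) * ‖b k‖ := by
    intro k
    have h1 : VarMetric.wnorm (U k).inverse (VarMetric.wproj C (U k).inverse (y k) -
        VarMetric.step C f (U k) (γ k) (x k)) ≤ 2 * β / √α * ‖b k‖ := by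
      have hp := (hU k).inner_wproj_nonpos hα hS.nonempty hC_closed hC_convex
      refine (VarMetric.wnorm_sub_le_of_inner_nonpos (hS.isPositive k)
        ((hp (y k)).2 _ (hS.step_mem k _)) ((hp _).2 _ (hp (y k)).1)).trans ?_
      refine (hS.wnorm_le k _).trans ?_
      rw [hy, sub_sub_sub_cancel_left, ← smul_sub, ← map_sub, sub_add_cancel_left, map_neg,
        smul_neg, norm_neg, norm_smul, Real.norm_eq_abs, abs_of_pos (hγ_pos k),
        div_mul_eq_mul_div]
      refine div_le_div_of_nonneg_right ?_ (Real.sqrt_nonneg α)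
      calc γ k * ‖U k (b k)‖ ≤ γ k * (‖U k‖ * ‖b k‖) := by
            have := hγ_pos k
            gcongr
            exact (U k).le_opNorm _
        _ = γ k * ‖U k‖ * ‖b k‖ := by ring
        _ ≤ 2 * β * ‖b k‖ := mul_le_mul_of_nonneg_right (hγ_lt k).le (norm_nonneg _)
    have h2 : e k = a k + (VarMetric.wproj C (U k).inverse (y k) -
        VarMetric.step C f (U k) (γ k) (x k)) := by
      simp only [he]
      abel
    rw [h2]
    refine (norm_add_le _ _).trans (add_le_add le_rfl ((hS.norm_le_wnorm k _).trans ?_))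
    rw [mul_assoc]
    gcongr
  have hI : VarMetric.Iteration C f α β μ U γ η lam e x :=
    { hS with
      η_nonneg := hη_nonneg
      η_summable := hη_sum
      inner_succ_le := fun k v => (hU k).inner_inverse_le_of_le hα (hU (k + 1))
        (by linarith [hη_nonneg k]) (hU_mono k) v
      lam_pos := hlam_pos
      lam_lt := hlam_lt
      error_summable := by
        refine (ha.add (hb.mul_left (√μ * (2 * β / √α)))).of_nonneg_of_le
          (fun k => mul_nonneg (hlam_pos k).le (norm_nonneg _)) fun k => ?_
        calc lam k * ‖e k‖ ≤ lam k * (‖a k‖ + √μ * (2 * β / √α) * ‖b k‖) :=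
              mul_le_mul_of_nonneg_left (he_le k) (hlam_pos k).le
          _ = _ := by ring
      x_succ := fun k => by
        rw [hx, add_assoc, ← smul_add]
        congr 2
        simp only [he]
        abel }
  refine ⟨fun xs hxs => hI.exists_tendsto_wnorm hxs, fun lam₀ τ hlam₀ hτ hlam => ?_,
    fun hdiv γ₀ ε hγ₀ hε hγ hγ_sum _ hU_sum => ?_⟩
  · have hres := hI.tendsto_residual_of_le hz hlam₀ hτ hlam
    exact ⟨hres, fun γ₀ hγ₀ hγ => ⟨hI.exists_weaklyConvergesTo hz hγ₀ hγ hres,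
      fun _ _ _ xs hxs => hI.tendsto_gradient hxs hγ₀ hγ hres⟩⟩
  · have hres := hI.tendsto_residual_of_summable hz hdiv hγ₀ hε hγ hγ_sum hU_sum
    have hγ' := fun k => (hγ k).1
    exact ⟨hres, hI.exists_weaklyConvergesTo hz hγ₀ hγ' hres,
      fun _ _ _ xs hxs => hI.tendsto_gradient hxs hγ₀ hγ' hres⟩
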